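/- Consider a game with $N$ players, action sets $A_i\subseteq\mathbb{R}^d$ with $0\in\operatorname{int}A_i$, and cost functions $J_i:\mathbb{R}^{Nd}\to\mathbb{R}$, $i=1,\dots,N$; put $A=A_1\times\dots\times A_N$. Norms are Euclidean. Assume: (1) each $A_i$ is convex and closed, and each $J_i$ is continuously differentiable on $\mathbb{R}^{Nd}$ and convex in $a^i$ for fixed $a^{-i}$; (2) each $A_i$ is compact; (3) the pseudo-gradient $M(a)=(\nabla_{a^i}J_i(a))_{i=1}^N$ is strongly monotone on $\mathbb{R}^{Nd}$ with a constant $\nu>0$, i.e. $\langle M(x)-M(y),x-y\rangle\ge\nu\|x-y\|^2$ for all $x,y\in\mathbb{R}^{Nd}$; (4) for some $\alpha<2$, $J_i(x)=O(\exp\{\|x\|^\alpha\})$ as $\|x\|\to\infty$ for every $i$; (5) $M$ is differentiable on $\mathbb{R}^{Nd}$, or $M$ is Lipschitz continuous on $\mathbb{R}^{Nd}$. Let $b,c>0$, $1\le r<s$ and, for $t=1,2,\dots$, $\gamma_t=\frac{4}{\nu t}$, $\sigma_t=\frac{b}{t^s}$, $\rho_t=\frac{c}{t^r}$. From an arbitrary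 (possibly random) initial joint state $\mu(1)\in\mathbb{R}^{Nd}$, run the following procedure for $t=1,2,\dots$: given the past (the states $\mu(1),\dots,\mu(t)$ and the samples $\xi(1),\dots,\xi(t-1)$), the players independently sample $\xi^i(t)\sim\mathcal N(\mu^i(t),\sigma_t^2 I_d)$ and play $a^i(t)=\mathrm{Proj}_{A_i}[\xi^i(t)]$; then, for every $i$, $$m^i(t)=\bigl(J_i(a(t))-J_i(\mu(t))\bigr)\frac{\xi^i(t)-\mu^i(t)}{\sigma_t^2},\qquad \mu^i(t+1)=\mathrm{Proj}_{(1-\rho_t)A_i}\bigl[\mu^i(t)-\gamma_t m^i(t)\bigr].$$ Then the game has exactly one Nash equilibrium $a^*$ (a point $a^*\in A$ with $J_i(a^{*})\le J_i(a^i,a^{*,-i})$ for all $i$ and all $a^i\in A_i$), the joint state $\mu(t)$ converges to $a^*$ almost surely, the joint sample $\xi(t)$ converges to $a^*$ in probability, $\mathrm{E}\|\mu(t)-a^*\|^2$ is finite for every $t\ge2$, and $$\mathrm{E}\|\mu(t)-a^*\|^2=O\!\left(\frac1t\right)\quad\text{as } t\to\infty .$$ -/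

import Mathlib

open MeasureTheory ProbabilityTheory Filter Topology Asymptotics
open scoped Pointwise RealInnerProductSpace

noncomputable section

/-- Actions of one player: `ℝ^d` with the Euclidean norm. -/
abbrev PlayerAction (d : ℕ) : Type := EuclideanSpace ℝ (Fin d)

/-- Joint actions of `N` players: `ℝ^{Nd}` with the Euclidean norm, split into `N` blocks. -/
abbrev Profile (N d : ℕ) : Type := PiLp 2 (fun _ : Fin N => PlayerAction d)

/-- The joint action in which player `i` plays `y` and all others play as in `x`. -/
def deviate {N d : ℕ} (x : Profile N d) (i : Fin N) (y : PlayerAction d) : Profile N d :=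
  WithLp.toLp 2 (Function.update (WithLp.ofLp x) i y)

/-- A game with `N` players, action sets `A i ⊆ ℝ^d` and cost functions defined on `ℝ^{Nd}`. -/
structure Game (N d : ℕ) where
  A : Fin N → Set (PlayerAction d)
  J : Fin N → Profile N d → ℝ

namespace Game

variable {N d : ℕ}

/-- The game is convex: closed convex action sets; every cost is continuously differentiable, and
convex in the player's own action. -/
structure IsConvex (G : Game N d) : Prop where
  convex : ∀ i, Convex ℝ (G.A i)
  closed : ∀ i, IsClosed (G.A i)
  contDiff : ∀ i, ContDiff ℝ 1 (G.J i)
  convexOn : ∀ i x, ConvexOn ℝ Set.univ (fun y => G.J i (deviate x i y))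

/-- The pseudo-gradient: block `i` is the gradient of `J i` in the action of player `i`. -/
def pseudoGradient (G : Game N d) (x : Profile N d) : Profile N d :=
  WithLp.toLp 2 (fun i => gradient (fun y => G.J i (deviate x i y)) (x i))

/-- The pseudo-gradient is strongly monotone on `ℝ^{Nd}` with constant `ν`. -/
def StronglyMonotone (G : Game N d) (ν : ℝ) : Prop :=
  ∀ x y : Profile N d, ν * ‖x - y‖ ^ 2 ≤ ⟪G.pseudoGradient x - G.pseudoGradient y, x - y⟫

/-- `J i x = O(exp(‖x‖^α))` as `‖x‖ → ∞`, for every player `i`. -/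
def GrowthBound (G : Game N d) (α : ℝ) : Prop :=
  ∀ i, G.J i =O[Bornology.cobounded (Profile N d)] (fun x => Real.exp (‖x‖ ^ α))

/-- Nash equilibrium. -/
def IsNash (G : Game N d) (a : Profile N d) : Prop :=
  (∀ i, a i ∈ G.A i) ∧ ∀ i, ∀ y ∈ G.A i, G.J i a ≤ G.J i (deviate a i y)

end Game

/-- `y` is the Euclidean projection of `x` on `K`. -/
def IsProj {d : ℕ} (K : Set (PlayerAction d)) (x y : PlayerAction d) : Prop :=
  y ∈ K ∧ ∀ z ∈ K, ‖x - y‖ ≤ ‖x - z‖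

/-- The normal distribution on `ℝ^d` with mean `m` and covariance matrix `σ² I`. -/
def playerLaw {d : ℕ} (m : PlayerAction d) (σ : ℝ) : Measure (PlayerAction d) :=
  (Measure.pi (fun k : Fin d => gaussianReal (m k) (σ ^ 2).toNNReal)).map (WithLp.toLp 2)

/-- The joint law of independent samples of all players, player `i` sampling from the normal
distribution with mean `m i` and covariance matrix `σ² I`. -/
def jointLaw {N d : ℕ} (m : Profile N d) (σ : ℝ) : Measure (Profile N d) :=
  (Measure.pi (fun i : Fin N => playerLaw (m i) σ)).map (WithLp.toLp 2)

/-- The σ-algebra generated by the states `μ(1), …, μ(t)` and the samples `ξ(1), …, ξ(t-1)`: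
what is known just before `ξ(t)` is sampled. -/
@[reducible] def history {Ω : Type*} {N d : ℕ} (μ ξ : ℕ → Ω → Profile N d) (t : ℕ) : MeasurableSpace Ω :=
  (⨆ k ∈ Finset.Icc 1 t, MeasurableSpace.comap (μ k) inferInstance) ⊔
    (⨆ k ∈ Finset.Ico 1 t, MeasurableSpace.comap (ξ k) inferInstance)

/-- The two-point estimate of block `i` of the pseudo-gradient, from the state `m`, the sample `x`
and the played joint action `a`. -/
def twoPointEstimate {N d : ℕ} (G : Game N d) (σ : ℝ) (m x a : Profile N d) (i : Fin N) :
    PlayerAction d :=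
  ((G.J i a - G.J i m) / σ ^ 2) • (x i - m i)

/-- The processes `μ` (states), `ξ` (samples) and `a` (played actions) are a run of the
payoff-based algorithm with two-point estimates, step sizes `γ`, standard deviations `σ` and
shrinking parameters `ρ`. Rounds are numbered `t = 1, 2, …`; the initial state `μ 1` is an
arbitrary random vector, in particular any deterministic one. -/
structure IsRun {Ω : Type*} [MeasurableSpace Ω] (P : Measure Ω) {N d : ℕ} (G : Game N d)
    (γ σ ρ : ℕ → ℝ) (μ ξ a : ℕ → Ω → Profile N d) : Prop where
  measurable_state : ∀ t, 1 ≤ t → Measurable (μ t)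
  measurable_sample : ∀ t, 1 ≤ t → Measurable (ξ t)
  /-- Given the past, `ξ(t)` has the law `jointLaw (μ(t)) σ_t`. -/
  sample : ∀ t, 1 ≤ t → ∀ B : Set (Profile N d), MeasurableSet B →
    P[(ξ t ⁻¹' B).indicator (fun _ => (1 : ℝ)) | history μ ξ t]
      =ᵐ[P] fun ω => (jointLaw (μ t ω) (σ t)).real B
  action : ∀ t, 1 ≤ t → ∀ ω i, IsProj (G.A i) (ξ t ω i) (a t ω i)
  update : ∀ t, 1 ≤ t → ∀ ω i,
    IsProj ((1 - ρ t) • G.A i)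
      (μ t ω i - γ t • twoPointEstimate G (σ t) (μ t ω) (ξ t ω) (a t ω) i) (μ (t + 1) ω i)

end

/-! ### Gaussian integration by parts -/

/-! Write the sample as `ξ = μ + σ z` with `z` standard Gaussian and independent of `μ`, and let `p`
be the projection on the joint action set. The argument is a mean-square recursion for the distance
from `μ(t+1)` to the shrunk equilibrium `(1 - ρ_t) a*`, which lies in the set projected on.

Size of the estimate: `p` is nonexpansive and the costs are Lipschitz on the compact action set, so
the difference of two costs is `O(σ ‖z‖)`. It cancels the factor `1/σ`, and the second moment of the
estimate stays bounded as `σ → 0` (`Surrogate.norm_estimate_le`).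

Drift: each cost is replaced by a compactly supported `f` with the same values and derivatives on
the action set. By Stein's identity a mean-zero term (`steinDefect`) can be subtracted from
`⟪estimate, μ - (1 - ρ) a*⟫`. While `ξ` is feasible, what remains is exactly the pseudo-gradient at
`ξ` paired with this direction, and strong monotonicity bounds it below by `ν ‖μ - a*‖²` up to `O(σ
‖z‖ + ρ)`. Since `μ` lies in a set shrunk by `ρ'`, infeasibility forces `σ ‖z‖ > ρ' ε`. That event
costs `O((σ/ρ')^k / σ)` for any `k`, and `s > r` allows a `k` making this `O(1/t)`
(`Surrogate.exists_drift_bound`).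

With `2 γ_t ν = 8/t`, all errors are `O(1/t²)`, including the motion of the reference point, and
`W_t ≤ (1 - 8/t) W_{t-1} + K/t²` gives the rate `O(1/t)`.

Almost sure convergence follows from the rate: along the squares `t = k²` the mean squared distances
are summable, and so are the mean squared variations between consecutive squares. Convergence of `ξ`
in probability is Chebyshev's inequality.

Nash equilibria are the solutions of the variational inequality of the pseudo-gradient. Existence
comes from Minty's lemma with Hahn–Banach separation and compactness, uniqueness from strong
monotonicity. -/

lemma hasDerivAt_gaussianPDFReal_zero_one (x : ℝ) :
    HasDerivAt (gaussianPDFReal 0 1) (-(x * gaussianPDFReal 0 1 x)) x := by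
  have h : gaussianPDFReal 0 1 =
      fun x => (Real.sqrt (2 * Real.pi * (1 : NNReal)))⁻¹ * Real.exp (-(x - 0) ^ 2 / (2 * (1 : NNReal))) := rfl
  have h1 : HasDerivAt (fun x : ℝ => -(x - 0) ^ 2 / (2 * ((1 : NNReal) : ℝ))) (-x) x := by
    have := (((hasDerivAt_id x).sub_const 0).pow 2).neg.div_const (2 * ((1 : NNReal) : ℝ))
    convert! this using 1
    simp
    ring
  rw [h]
  convert! (h1.exp.const_mul _) using 1
  simp only []
  ring

/-- The Stein identity for the standard normal distribution on the line. -/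
lemma integral_mul_id_gaussianReal {u u' : ℝ → ℝ} (hu : ∀ x, HasDerivAt u (u' x) x)
    (hu' : Continuous u') {C : ℝ} (hC : ∀ x, |u x| ≤ C) (hC' : ∀ x, |u' x| ≤ C) :
    ∫ x, u x * x ∂gaussianReal 0 1 = ∫ x, u' x ∂gaussianReal 0 1 := by
  have hcu : Continuous u := continuous_iff_continuousAt.2 fun x => (hu x).continuousAt
  have hφ := integrable_gaussianPDFReal 0 1
  have hid : Integrable (fun x : ℝ => x * gaussianPDFReal 0 1 x) := by
    have h := (memLp_id_gaussianReal (μ := 0) (v := 1) 1).integrable (by simp)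
    rw [gaussianReal_of_var_ne_zero _ one_ne_zero,
      integrable_withDensity_iff (measurable_gaussianPDF _ _) (by simp [gaussianPDF_lt_top])] at h
    simpa using h
  rw [integral_gaussianReal_eq_integral_smul one_ne_zero,
    integral_gaussianReal_eq_integral_smul one_ne_zero]
  have key := integral_mul_deriv_eq_deriv_mul_of_integrable (u := u) (u' := u')
    (v := gaussianPDFReal 0 1) (v' := fun x => -(x * gaussianPDFReal 0 1 x))
    (fun x _ => hu x) (fun x _ => hasDerivAt_gaussianPDFReal_zero_one x)
    (hid.neg.bdd_mul hcu.aestronglyMeasurable (c := C) (ae_of_all _ hC))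
    (hφ.bdd_mul hu'.aestronglyMeasurable (c := C) (ae_of_all _ hC'))
    (hφ.bdd_mul hcu.aestronglyMeasurable (c := C) (ae_of_all _ hC))
  simp only [mul_neg, integral_neg, neg_inj] at key
  simp only [smul_eq_mul]
  calc _ = ∫ x, u x * (x * gaussianPDFReal 0 1 x) := by congr 1; ext x; ring
    _ = _ := by rw [key]; congr 1; ext x; ring

/-- Resampling one coordinate of a product of probability measures does not change its law. -/
lemma measurePreserving_update {ι : Type*} [Fintype ι] [DecidableEq ι] {α : ι → Type*}
    [∀ j, MeasurableSpace (α j)] (m : ∀ j, Measure (α j)) [∀ j, IsProbabilityMeasure (m j)]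
    (i : ι) :
    MeasurePreserving (fun p : (∀ j, α j) × α i => Function.update p.1 i p.2)
      ((Measure.pi m).prod (m i)) (Measure.pi m) := by
  have hmeas : Measurable (fun p : (∀ j, α j) × α i => Function.update p.1 i p.2) := by
    refine measurable_pi_lambda _ fun j => ?_
    by_cases h : j = i
    · subst h; simpa using measurable_snd
    · simp only [Function.update_of_ne h]
      exact (measurable_pi_apply j).comp measurable_fst
  refine ⟨hmeas, (Measure.pi_eq fun s hs => ?_).symm⟩
  rw [Measure.map_apply hmeas (MeasurableSet.univ_pi hs)]
  have hpre : (fun p : (∀ j, α j) × α i => Function.update p.1 i p.2) ⁻¹' Set.univ.pi s =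
      (Set.univ.pi (Function.update s i Set.univ)) ×ˢ s i := by
    ext ⟨x, y⟩
    simp only [Set.mem_preimage, Set.mem_pi, Set.mem_univ, true_imp_iff, Set.mem_prod]
    constructor
    · intro h
      refine ⟨fun j => ?_, by simpa using h i⟩
      by_cases hj : j = i
      · subst hj; simp
      · simpa [Function.update_of_ne hj] using h j
    · rintro ⟨h1, h2⟩ j
      by_cases hj : j = i
      · subst hj; simpa using h2
      · simpa [Function.update_of_ne hj] using h1 j
  rw [hpre, Measure.prod_prod, Measure.pi_pi, ← Finset.mul_prod_erase _ _ (Finset.mem_univ i),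
    ← Finset.mul_prod_erase Finset.univ (fun j => m j (s j)) (Finset.mem_univ i)]
  simp only [Function.update_self, measure_univ, one_mul]
  rw [mul_comm]
  congr 1
  exact Finset.prod_congr rfl fun j hj => by
    rw [Function.update_of_ne (Finset.ne_of_mem_erase hj)]

/-! ### Stein's identity in a Euclidean space -/

section Stein

variable {E : Type*} [NormedAddCommGroup E] [InnerProductSpace ℝ E] [FiniteDimensional ℝ E]
  [MeasurableSpace E] [BorelSpace E]

lemma integrable_norm_pow_stdGaussian (k : ℕ) :
    Integrable (fun z : E => ‖z‖ ^ k) (stdGaussian E) := by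
  exact (IsGaussian.memLp_id (stdGaussian E) k (by simp)).integrable_norm_pow'

/-- Resampling the coordinate along `b i` preserves the Gaussian law, so by Fubini both sides become
averages of integrals along lines in direction `b i`, where the one-dimensional identity applies. -/
lemma integral_mul_inner_basis_stdGaussian {ι : Type*} [Fintype ι] [DecidableEq ι]
    (b : OrthonormalBasis ι ℝ E) (i : ι) {h : E → ℝ} (hh : ContDiff ℝ 1 h)
    (hs : HasCompactSupport h) :
    ∫ z, h z * ⟪b i, z⟫ ∂stdGaussian E = ∫ z, fderiv ℝ h z (b i) ∂stdGaussian E := by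
  have hcd : Continuous (fun z => fderiv ℝ h z (b i)) :=
    (hh.continuous_fderiv one_ne_zero).clm_apply continuous_const
  obtain ⟨C₁, hC₁⟩ := hh.continuous.bounded_above_of_compact_support hs
  obtain ⟨C₂, hC₂⟩ := hcd.bounded_above_of_compact_support (hs.fderiv_apply ℝ (b i))
  have hInt₁ : Integrable (fun z => h z * ⟪b i, z⟫) (stdGaussian E) := by
    refine Integrable.bdd_mul ?_ hh.continuous.aestronglyMeasurable (ae_of_all _ hC₁)
    exact IsGaussian.integrable_id.const_inner (b i)
  have hInt₂ : Integrable (fun z => fderiv ℝ h z (b i)) (stdGaussian E) :=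
    (integrable_const C₂).mono' hcd.aestronglyMeasurable (ae_of_all _ hC₂)
  set T : (ι → ℝ) → E := fun x => ∑ j, x j • b j with hT
  have hTm : Measurable T := by fun_prop
  have hTu : ∀ (x : ι → ℝ) y, T (Function.update x i y) = T x + (y - x i) • b i := by
    intro x y
    have : Function.update x i y = x + (y - x i) • Pi.single i (1 : ℝ) := by
      ext j
      by_cases hj : j = i
      · subst hj; simp
      · simp [hj]
    rw [this]
    simp [hT, add_smul, Finset.sum_add_distrib, Pi.single_apply]
  have hTi : ∀ x : ι → ℝ, ⟪b i, T x⟫ = x i := fun x => by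
    simp [hT, inner_sum, inner_smul_right, b.inner_eq_ite]
  have hmp := measurePreserving_update (fun _ : ι => gaussianReal 0 1) i
  have hcomp : MeasurePreserving T (Measure.pi fun _ : ι => gaussianReal 0 1) (stdGaussian E) :=
    ⟨hTm, (stdGaussian_eq_map_pi_orthonormalBasis b).symm⟩
  have hmp2 := hcomp.comp hmp
  have e1 : ∀ F : E → ℝ, Integrable F (stdGaussian E) → ∫ z, F z ∂stdGaussian E =
      ∫ x, ∫ y, F (T x + (y - x i) • b i) ∂gaussianReal 0 1
        ∂(Measure.pi fun _ : ι => gaussianReal 0 1) := by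
    intro F hF
    rw [← hmp2.map_eq, integral_map hmp2.aemeasurable (by rw [hmp2.map_eq]; exact hF.1),
      integral_prod]
    · simp [hTu]
    · exact hmp2.integrable_comp_of_integrable hF
  rw [e1 _ hInt₁, e1 _ hInt₂]
  congr 1
  ext x
  have hline : ∀ y : ℝ, ⟪b i, T x + (y - x i) • b i⟫ = y := fun y => by
    simp [inner_add_right, hTi, inner_smul_right]
  simp_rw [hline]
  have hd : ∀ y : ℝ, HasDerivAt (fun y : ℝ => T x + (y - x i) • b i) (b i) y := fun y => by
    simpa using (((hasDerivAt_id y).sub_const (x i)).smul_const (b i)).const_add (T x)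
  refine integral_mul_id_gaussianReal (C := max C₁ C₂) (fun y => ?_) ?_ ?_ ?_
  · exact ((hh.differentiable one_ne_zero _).hasFDerivAt).comp_hasDerivAt y (hd y)
  · exact hcd.comp (by fun_prop)
  · exact fun y => (hC₁ _).trans (le_max_left _ _)
  · exact fun y => (hC₂ _).trans (le_max_right _ _)

/-- The Stein identity for the standard Gaussian measure. -/
lemma integral_mul_inner_stdGaussian (v : E) {h : E → ℝ} (hh : ContDiff ℝ 1 h)
    (hs : HasCompactSupport h) :
    ∫ z, h z * ⟪z, v⟫ ∂stdGaussian E = ∫ z, fderiv ℝ h z v ∂stdGaussian E := by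
  set b := stdOrthonormalBasis ℝ E
  obtain ⟨C₁, hC₁⟩ := hh.continuous.bounded_above_of_compact_support hs
  have hv : v = ∑ i, ⟪b i, v⟫ • b i := (b.sum_repr' v).symm
  have e1 : ∀ z, h z * ⟪z, v⟫ = ∑ i, ⟪b i, v⟫ * (h z * ⟪b i, z⟫) := fun z => by
    rw [← b.sum_inner_mul_inner z v, Finset.mul_sum]
    refine Finset.sum_congr rfl fun i _ => ?_
    rw [real_inner_comm]; ring
  have e2 : ∀ z, fderiv ℝ h z v = ∑ i, ⟪b i, v⟫ * fderiv ℝ h z (b i) := fun z => by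
    conv_lhs => rw [hv]
    simp [map_sum]
  simp_rw [e1, e2]
  rw [integral_finsetSum, integral_finsetSum]
  · refine Finset.sum_congr rfl fun i _ => ?_
    rw [integral_const_mul, integral_const_mul, integral_mul_inner_basis_stdGaussian b i hh hs]
  · intro i _
    refine Integrable.const_mul ?_ _
    have hcd : Continuous (fun z => fderiv ℝ h z (b i)) :=
      (hh.continuous_fderiv one_ne_zero).clm_apply continuous_const
    obtain ⟨C₂, hC₂⟩ := hcd.bounded_above_of_compact_support (hs.fderiv_apply ℝ (b i))
    exact (integrable_const C₂).mono' hcd.aestronglyMeasurable (ae_of_all _ hC₂)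
  · intro i _
    refine Integrable.const_mul ?_ _
    refine Integrable.bdd_mul ?_ hh.continuous.aestronglyMeasurable (ae_of_all _ hC₁)
    exact IsGaussian.integrable_id.const_inner (b i)

lemma integral_affine_mul_inner_stdGaussian {σ : ℝ} (hσ : σ ≠ 0) (m v : E) {f : E → ℝ}
    (hf : ContDiff ℝ 1 f) (hs : HasCompactSupport f) :
    ∫ z, f (σ • z + m) * ⟪z, v⟫ ∂stdGaussian E =
      σ * ∫ z, fderiv ℝ f (σ • z + m) v ∂stdGaussian E := by
  have hs' : HasCompactSupport fun z => f (σ • z + m) :=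
    hs.comp_homeomorph ((Homeomorph.smulOfNeZero σ hσ).trans (Homeomorph.addRight m))
  rw [integral_mul_inner_stdGaussian (h := fun z => f (σ • z + m)) _ (hf.comp (by fun_prop)) hs',
    ← integral_const_mul]
  congr 1
  ext z
  have hd : HasFDerivAt (fun z : E => σ • z + m) (σ • ContinuousLinearMap.id ℝ E) z :=
    ((hasFDerivAt_id z).const_smul σ).add_const m
  have e := ((hf.differentiable one_ne_zero (σ • z + m)).hasFDerivAt.comp z hd).fderiv
  rw [Function.comp_def] at e
  rw [e]
  simp

end Stein

/-! ### The law of the samples -/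

lemma charFun_playerLaw {d : ℕ} (m : PlayerAction d) (σ : ℝ) (t : PlayerAction d) :
    charFun (playerLaw m σ) t =
      Complex.exp (⟪m, t⟫ * Complex.I - σ ^ 2 * ‖t‖ ^ 2 / 2) := by
  rw [playerLaw, charFun_pi]
  simp_rw [charFun_gaussianReal, ← Complex.exp_sum, ← Complex.ofReal_pow,
    EuclideanSpace.real_norm_sq_eq]
  congr 1
  rw [Finset.sum_sub_distrib, PiLp.inner_apply, Real.coe_toNNReal _ (sq_nonneg σ)]
  push_cast
  simp only [Finset.sum_mul, Finset.mul_sum, Finset.sum_div]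
  congr 1
  refine Finset.sum_congr rfl fun i _ => ?_
  simp

instance isProbabilityMeasure_playerLaw {d : ℕ} (m : PlayerAction d) (σ : ℝ) :
    IsProbabilityMeasure (playerLaw m σ) :=
  Measure.isProbabilityMeasure_map (by fun_prop)

instance isProbabilityMeasure_jointLaw {N d : ℕ} (m : Profile N d) (σ : ℝ) :
    IsProbabilityMeasure (jointLaw m σ) :=
  Measure.isProbabilityMeasure_map (by fun_prop)

/-- The characteristic functions agree. This trades the nested product measure for an affine image
of a single Gaussian that does not depend on the state. -/
lemma jointLaw_eq_map_stdGaussian {N d : ℕ} (m : Profile N d) (σ : ℝ) :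
    jointLaw m σ = (stdGaussian (Profile N d)).map (fun z => σ • z + m) := by
  have : IsProbabilityMeasure ((stdGaussian (Profile N d)).map (fun z => σ • z + m)) :=
    Measure.isProbabilityMeasure_map (by fun_prop)
  apply Measure.ext_of_charFun
  ext t
  have e : (stdGaussian (Profile N d)).map (fun z => σ • z + m) =
      ((stdGaussian (Profile N d)).map (σ • ·)).map (· + m) := by
    rw [Measure.map_map (by fun_prop) (by fun_prop)]; rfl
  rw [e, charFun_map_add_const, charFun_map_smul, charFun_stdGaussian, jointLaw, charFun_pi]
  simp_rw [charFun_playerLaw]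
  rw [← Complex.exp_sum, ← Complex.exp_add]
  congr 1
  have hn : ‖σ • t‖ ^ 2 = σ ^ 2 * ∑ i, ‖t i‖ ^ 2 := by
    rw [norm_smul, mul_pow, PiLp.norm_sq_eq_of_L2, Real.norm_eq_abs, sq_abs]
  rw [Finset.sum_sub_distrib, PiLp.inner_apply, ← Complex.ofReal_pow ‖σ • t‖, hn]
  push_cast
  simp only [Finset.sum_mul, Finset.mul_sum]
  rw [sub_eq_add_neg, add_comm, neg_div, Finset.sum_div]

/-- If, given a σ-algebra for which the state `X` is measurable, the sample `Y` has the law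
`jointLaw X σ`, then the normalized sample is standard Gaussian and independent of `X`. -/
lemma map_state_noise {Ω : Type*} {m mΩ : MeasurableSpace Ω} (hm : m ≤ mΩ) (P : Measure Ω)
    [IsProbabilityMeasure P] {N d : ℕ} {X Y : Ω → Profile N d} {σ : ℝ} (hσ : σ ≠ 0)
    (hX : Measurable[m] X) (hY : Measurable Y)
    (hs : ∀ B : Set (Profile N d), MeasurableSet B →
      P[(Y ⁻¹' B).indicator (fun _ => (1 : ℝ)) | m] =ᵐ[P] fun ω => (jointLaw (X ω) σ).real B) :
    P.map (fun ω => (X ω, σ⁻¹ • (Y ω - X ω))) =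
      (P.map X).prod (stdGaussian (Profile N d)) := by
  have hX' : Measurable X := hX.mono hm le_rfl
  have : IsProbabilityMeasure (P.map X) := Measure.isProbabilityMeasure_map hX'.aemeasurable
  set T : Profile N d × Profile N d → Profile N d × Profile N d :=
    fun p => (p.1, σ • p.2 + p.1) with hT
  have hTm : Measurable T := by fun_prop
  have key : P.map (fun ω => (X ω, Y ω)) =
      ((P.map X).prod (stdGaussian (Profile N d))).map T := by
    have : IsProbabilityMeasure (P.map (fun ω => (X ω, Y ω))) :=
      Measure.isProbabilityMeasure_map (hX'.prodMk hY).aemeasurable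
    refine Measure.ext_prod fun {S B} hS hB => ?_
    rw [Measure.map_apply (hX'.prodMk hY) (hS.prod hB), Measure.map_apply hTm (hS.prod hB),
      Measure.prod_apply (hTm (hS.prod hB))]
    have e1 : ∀ x, stdGaussian (Profile N d) (Prod.mk x ⁻¹' (T ⁻¹' S ×ˢ B)) =
        S.indicator (fun x => jointLaw x σ B) x := by
      intro x
      by_cases hx : x ∈ S
      · rw [Set.indicator_of_mem hx, jointLaw_eq_map_stdGaussian,
          Measure.map_apply (by fun_prop) hB]
        congr 1
        ext z
        simp [hT, hx]
      · rw [Set.indicator_of_notMem hx]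
        convert! measure_empty (μ := stdGaussian (Profile N d))
        ext z
        simp [hT, hx]
    have hmeas : Measurable fun x : Profile N d => S.indicator (fun x => jointLaw x σ B) x := by
      simp_rw [← e1]
      exact measurable_measure_prodMk_left (hTm (hS.prod hB))
    simp_rw [e1]
    rw [lintegral_map hmeas hX']
    -- The conditional law is tested on `X ⁻¹' S`, which belongs to `m` because `X` is
    -- `m`-measurable. Rectangles `S ×ˢ B` determine the joint law.
    have e2 : ∫ ω in X ⁻¹' S, (Y ⁻¹' B).indicator (fun _ => (1 : ℝ)) ω ∂P =
        ∫ ω in X ⁻¹' S, (jointLaw (X ω) σ).real B ∂P := by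
      rw [← setIntegral_condExp hm _ (hX hS)]
      · exact setIntegral_congr_ae (hm _ (hX hS)) ((hs B hB).mono fun _ h _ => h)
      · exact (integrable_const _).indicator (hY hB)
    have hpre : (fun ω => (X ω, Y ω)) ⁻¹' S ×ˢ B = Y ⁻¹' B ∩ X ⁻¹' S := by
      ext ω; simp [and_comm]
    rw [show (fun _ : Ω => (1 : ℝ)) = 1 from rfl, integral_indicator_one (hY hB), Measure.real,
      Measure.restrict_apply (hY hB), ← hpre,
      integral_eq_lintegral_of_nonneg_ae (ae_of_all _ fun _ => measureReal_nonneg)] at e2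
    · rw [ENNReal.toReal_eq_toReal_iff' (measure_ne_top _ _)] at e2
      · rw [e2]
        simp only [Measure.real, ENNReal.ofReal_toReal (measure_ne_top (jointLaw _ σ) B)]
        rw [← lintegral_indicator (hX' hS)]
        rfl
      · refine ((lintegral_mono (g := fun _ => 1) fun ω => ?_).trans_lt ?_).ne
        · exact (ENNReal.ofReal_le_ofReal measureReal_le_one).trans (by simp)
        · simp
    · refine Measurable.aestronglyMeasurable ?_
      have h0 := measurable_measure_prodMk_left (ν := stdGaussian (Profile N d))
        (hTm (MeasurableSet.univ.prod hB))
      have h1 : (fun ω => (jointLaw (X ω) σ).real B) = fun ω =>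
          (stdGaussian (Profile N d) (Prod.mk (X ω) ⁻¹' (T ⁻¹' Set.univ ×ˢ B))).toReal := by
        ext ω
        rw [Measure.real, jointLaw_eq_map_stdGaussian, Measure.map_apply (by fun_prop) hB]
        congr 2
        ext z
        simp [hT]
      rw [h1]
      exact (h0.comp hX').ennreal_toReal
  have e3 : (fun ω => (X ω, σ⁻¹ • (Y ω - X ω))) =
      (fun p : Profile N d × Profile N d => (p.1, σ⁻¹ • (p.2 - p.1))) ∘ fun ω => (X ω, Y ω) := rfl
  rw [e3, ← Measure.map_map (by fun_prop) (hX'.prodMk hY), key,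
    Measure.map_map (by fun_prop) hTm]
  convert! Measure.map_id
  ext p : 1
  simp [hT, smul_smul, inv_mul_cancel₀ hσ]

/-! ### The noise along a run is independent of the current state -/

section Run

variable {Ω : Type*} {N d : ℕ} {G : Game N d} {γ σ ρ : ℕ → ℝ} {μ ξ a : ℕ → Ω → Profile N d}

lemma measurable_state_history {t : ℕ} (ht : 1 ≤ t) : Measurable[history μ ξ t] (μ t) := by
  refine Measurable.of_comap_le (le_sup_of_le_left ?_)
  exact le_iSup₂_of_le t (Finset.mem_Icc.2 ⟨ht, le_rfl⟩) le_rfl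

variable [mΩ : MeasurableSpace Ω] {P : Measure Ω}

lemma IsRun.history_le (h : IsRun P G γ σ ρ μ ξ a) (t : ℕ) : history μ ξ t ≤ mΩ := by
  refine sup_le (iSup₂_le fun k hk => ?_) (iSup₂_le fun k hk => ?_)
  · exact (h.measurable_state k (Finset.mem_Icc.1 hk).1).comap_le
  · exact (h.measurable_sample k (Finset.mem_Ico.1 hk).1).comap_le

variable [IsProbabilityMeasure P]

lemma IsRun.map_state_noise (h : IsRun P G γ σ ρ μ ξ a) {t : ℕ} (ht : 1 ≤ t) (hσ : σ t ≠ 0) :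
    P.map (fun ω => (μ t ω, (σ t)⁻¹ • (ξ t ω - μ t ω))) =
      (P.map (μ t)).prod (stdGaussian (Profile N d)) :=
  _root_.map_state_noise (h.history_le t) P hσ (measurable_state_history ht)
    (h.measurable_sample t ht) (h.sample t ht)

lemma IsRun.measurePreserving_noise (h : IsRun P G γ σ ρ μ ξ a) {t : ℕ} (ht : 1 ≤ t)
    (hσ : σ t ≠ 0) :
    MeasurePreserving (fun ω => (σ t)⁻¹ • (ξ t ω - μ t ω)) P (stdGaussian (Profile N d)) := by
  have hμ := h.measurable_state t ht
  have hξ := h.measurable_sample t ht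
  have : IsProbabilityMeasure (P.map (μ t)) := Measure.isProbabilityMeasure_map hμ.aemeasurable
  have h2 : Measurable (fun ω => (μ t ω, (σ t)⁻¹ • (ξ t ω - μ t ω))) := by fun_prop
  refine ⟨by fun_prop, ?_⟩
  have := congrArg (Measure.map Prod.snd) (h.map_state_noise ht hσ)
  rw [Measure.map_map measurable_snd h2, Measure.map_snd_prod] at this
  simpa [Function.comp_def] using this

/-- Conditioning on the state: the noise is integrated out first. -/
lemma IsRun.integral_state_noise (h : IsRun P G γ σ ρ μ ξ a) {t : ℕ} (ht : 1 ≤ t)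
    (hσ : σ t ≠ 0) {g : Profile N d → Profile N d → ℝ} (hg : Measurable (Function.uncurry g))
    (hInt : Integrable (fun ω => g (μ t ω) ((σ t)⁻¹ • (ξ t ω - μ t ω))) P) :
    Integrable (fun ω => ∫ z, g (μ t ω) z ∂stdGaussian (Profile N d)) P ∧
    ∫ ω, g (μ t ω) ((σ t)⁻¹ • (ξ t ω - μ t ω)) ∂P =
      ∫ ω, ∫ z, g (μ t ω) z ∂stdGaussian (Profile N d) ∂P := by
  have hμ := h.measurable_state t ht
  have hξ := h.measurable_sample t ht
  have : IsProbabilityMeasure (P.map (μ t)) := Measure.isProbabilityMeasure_map hμ.aemeasurable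
  have h2 : Measurable (fun ω => (μ t ω, (σ t)⁻¹ • (ξ t ω - μ t ω))) := by fun_prop
  have hi : Integrable (Function.uncurry g)
      ((P.map (μ t)).prod (stdGaussian (Profile N d))) := by
    rw [← h.map_state_noise ht hσ, integrable_map_measure hg.aestronglyMeasurable h2.aemeasurable]
    exact hInt
  have hi' := hi.integral_prod_left
  refine ⟨(integrable_map_measure hi'.1 hμ.aemeasurable).1 hi', ?_⟩
  have e := integral_map (μ := P) h2.aemeasurable
    (f := Function.uncurry g) hg.aestronglyMeasurable
  rw [h.map_state_noise ht hσ, integral_prod _ hi, integral_map hμ.aemeasurable hi'.1] at e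
  exact e.symm

end Run

/-! ### Variational inequalities -/

section VariationalInequality

variable {E : Type*} [NormedAddCommGroup E] [InnerProductSpace ℝ E]

/-- For a monotone map, finitely many Minty inequalities have a common solution. -/
lemma exists_minty_finite {K : Set E} (hK : IsCompact K) (hc : Convex ℝ K) (hne : K.Nonempty)
    {M : E → E} (hM : ∀ x ∈ K, ∀ y ∈ K, 0 ≤ ⟪M x - M y, x - y⟫) {ι : Type*} [Fintype ι]
    (y : ι → E) (hy : ∀ j, y j ∈ K) :
    ∃ x ∈ K, ∀ j, 0 ≤ ⟪M (y j), y j - x⟫ := by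
  classical
  by_contra! hcon
  set F : E → ι → ℝ := fun x j => ⟪M (y j), y j - x⟫ with hF
  have hFc : Continuous F := by
    refine continuous_pi fun j => ?_
    fun_prop
  have hconv : Convex ℝ (F '' K) := by
    rintro _ ⟨x, hx, rfl⟩ _ ⟨z, hz, rfl⟩ p q hp hq hpq
    refine ⟨p • x + q • z, hc hx hz hp hq hpq, ?_⟩
    ext j
    have : y j - (p • x + q • z) = p • (y j - x) + q • (y j - z) := by
      rw [smul_sub, smul_sub, sub_add_sub_comm, ← add_smul, hpq, one_smul]
    simp [hF, this, inner_add_right, inner_smul_right]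
  have hDc : Convex ℝ {w : ι → ℝ | ∀ j, 0 ≤ w j} := by
    intro w hw u hu p q hp hq _ j
    have := hw j
    have := hu j
    simp only [Pi.add_apply, Pi.smul_apply, smul_eq_mul]
    positivity
  have hDcl : IsClosed {w : ι → ℝ | ∀ j, 0 ≤ w j} := by
    simp only [Set.ofPred_forall]
    exact isClosed_iInter fun j => isClosed_le continuous_const (continuous_apply j)
  have hdis : Disjoint (F '' K) {w : ι → ℝ | ∀ j, 0 ≤ w j} := by
    rw [Set.disjoint_left]
    rintro _ ⟨x, hx, rfl⟩ h
    obtain ⟨j, hj⟩ := hcon x hx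
    exact absurd (h j) (not_le.2 hj)
  obtain ⟨f, u, v, hu, huv, hv⟩ :=
    geometric_hahn_banach_compact_closed hconv (hK.image hFc) hDc hDcl hdis
  have hv0 : v < 0 := by simpa using hv 0 (by simp)
  have hneg : ∀ x ∈ K, f (F x) < 0 := fun x hx =>
    (hu _ ⟨x, hx, rfl⟩).trans (huv.trans hv0)
  set w : ι → ℝ := fun j => f (Pi.single j 1) with hw
  have hf : ∀ c : ι → ℝ, f c = ∑ j, c j * w j := by
    intro c
    conv_lhs => rw [pi_eq_sum_univ' c]
    simp only [map_sum, map_smul, smul_eq_mul, hw]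
  have hw0 : ∀ j, 0 ≤ w j := by
    intro j
    by_contra! hj
    -- If `w j < 0`, this point of the orthant has `f`-value exactly `v`, against strict separation.
    have h1 := hv ((v / w j) • Pi.single j 1) (fun k => by
      have : 0 ≤ v / w j := div_nonneg_of_nonpos hv0.le hj.le
      by_cases hk : k = j
      · subst hk; simpa using this
      · simp [hk])
    rw [map_smul, smul_eq_mul] at h1
    change v < v / w j * w j at h1
    rw [div_mul_cancel₀ _ hj.ne] at h1
    exact lt_irrefl _ h1
  obtain ⟨x₀, hx₀⟩ := hne
  have hpos : 0 < ∑ j, w j := by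
    refine lt_of_le_of_ne (Finset.sum_nonneg fun j _ => hw0 j) fun h0 => ?_
    have hz := (Finset.sum_eq_zero_iff_of_nonneg fun j _ => hw0 j).1 h0.symm
    have := hneg x₀ hx₀
    rw [hf, Finset.sum_eq_zero fun j hj => by rw [hz j hj, mul_zero]] at this
    exact lt_irrefl _ this
  set W := ∑ j, w j with hW
  -- The contradiction arises at the barycentre of the `y j` with the weights of the separating
  -- functional.
  have hxK := hc.sum_mem (t := Finset.univ) (w := fun j => w j / W) (z := y)
    (fun j _ => div_nonneg (hw0 j) hpos.le)
    (by rw [← Finset.sum_div, div_self hpos.ne']) (fun j _ => hy j)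
  set x := ∑ j, (w j / W) • y j with hx
  have hWx : W • x = ∑ k, w k • y k := by
    rw [hx, Finset.smul_sum]
    refine Finset.sum_congr rfl fun j _ => ?_
    rw [smul_smul, mul_div_cancel₀ _ hpos.ne']
  have h1 : W * f (F x) = ∑ j, ∑ k, w j * w k * ⟪M (y j), y j - y k⟫ := by
    rw [hf, Finset.mul_sum]
    refine Finset.sum_congr rfl fun j _ => ?_
    have : W • (y j - x) = ∑ k, w k • (y j - y k) := by
      rw [smul_sub, hWx, hW, Finset.sum_smul, ← Finset.sum_sub_distrib]
      simp only [smul_sub]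
    calc W * (F x j * w j) = w j * ⟪M (y j), W • (y j - x)⟫ := by
          rw [inner_smul_right]; simp only [hF]; ring
      _ = _ := by
          rw [this, inner_sum, Finset.mul_sum]
          refine Finset.sum_congr rfl fun k _ => ?_
          rw [inner_smul_right]; ring
  -- Symmetrizing the double sum in `j` and `k` pairs its terms into `⟪M (y j) - M (y k), y j - y
  -- k⟫`, which is nonnegative by monotonicity.
  have h2 : 0 ≤ 2 * (W * f (F x)) := by
    have hsw : W * f (F x) = ∑ j, ∑ k, w j * w k * ⟪M (y k), y k - y j⟫ := by
      rw [h1, Finset.sum_comm]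
      refine Finset.sum_congr rfl fun j _ => Finset.sum_congr rfl fun k _ => ?_
      rw [mul_comm (w k)]
    rw [two_mul]
    nth_rewrite 1 [h1]
    rw [hsw, ← Finset.sum_add_distrib]
    refine Finset.sum_nonneg fun j _ => ?_
    rw [← Finset.sum_add_distrib]
    refine Finset.sum_nonneg fun k _ => ?_
    rw [← mul_add]
    refine mul_nonneg (mul_nonneg (hw0 j) (hw0 k)) ?_
    have := hM (y j) (hy j) (y k) (hy k)
    rw [inner_sub_left] at this
    rw [← neg_sub (y j) (y k), inner_neg_right]
    linarith
  have h3 : W * f (F x) < 0 := mul_neg_of_pos_of_neg hpos (hneg x hxK)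
  linarith

/-- A continuous monotone map has a solution of its variational inequality on every nonempty
compact convex set. -/
lemma exists_variational_inequality {K : Set E} (hK : IsCompact K) (hc : Convex ℝ K)
    (hne : K.Nonempty) {M : E → E} (hMc : Continuous M)
    (hM : ∀ x ∈ K, ∀ y ∈ K, 0 ≤ ⟪M x - M y, x - y⟫) :
    ∃ x ∈ K, ∀ z ∈ K, 0 ≤ ⟪M x, z - x⟫ := by
  have hclosed : ∀ y : K, IsClosed {x : E | 0 ≤ ⟪M y, (y : E) - x⟫} := fun y =>
    isClosed_le continuous_const (by fun_prop)
  -- The finite intersection property yields one `x` satisfying all Minty inequalities.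
  obtain ⟨x, hx, hx'⟩ := hK.inter_iInter_nonempty
    (fun y : K => {x : E | 0 ≤ ⟪M y, (y : E) - x⟫}) hclosed (by
      intro s
      obtain ⟨x, hx, h⟩ := exists_minty_finite hK hc hne hM (fun j : s => ((j : K) : E))
        (fun j => (j : K).2)
      exact ⟨x, hx, Set.mem_iInter₂.2 fun j hj => h ⟨j, hj⟩⟩)
  rw [Set.mem_iInter] at hx'
  refine ⟨x, hx, fun z hz => ?_⟩
  -- Minty's trick: test at a point of the segment towards `z`, divide by `τ`, and let `τ → 0` by
  -- continuity.
  have hlim : Tendsto (fun τ : ℝ => ⟪M (x + τ • (z - x)), z - x⟫) (𝓝[>] 0)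
      (𝓝 ⟪M x, z - x⟫) := by
    have : Continuous (fun τ : ℝ => ⟪M (x + τ • (z - x)), z - x⟫) := by fun_prop
    simpa using (this.tendsto 0).mono_left nhdsWithin_le_nhds
  refine ge_of_tendsto hlim ?_
  filter_upwards [Ioo_mem_nhdsGT (zero_lt_one' ℝ)] with τ hτ
  have hmem : x + τ • (z - x) ∈ K := by
    have := hc hx hz (sub_nonneg.2 hτ.2.le) hτ.1.le (by ring)
    convert! this using 1
    rw [smul_sub, sub_smul, one_smul]; abel
  have h1 : 0 ≤ ⟪M (x + τ • (z - x)), (x + τ • (z - x)) - x⟫ := hx' ⟨_, hmem⟩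
  rw [add_sub_cancel_left, inner_smul_right] at h1
  exact nonneg_of_mul_nonneg_right h1 hτ.1

end VariationalInequality

/-! ### Euclidean projections -/

section Proj

variable {d : ℕ} {K : Set (PlayerAction d)}

lemma IsProj.inner_le_zero (hK : Convex ℝ K) {x y z : PlayerAction d} (h : IsProj K x y)
    (hz : z ∈ K) : ⟪x - y, z - y⟫ ≤ 0 := by
  refine (norm_eq_iInf_iff_real_inner_le_zero hK h.1).1 ?_ z hz
  have : Nonempty K := ⟨⟨y, h.1⟩⟩
  refine le_antisymm (le_ciInf fun w => h.2 w w.2) ?_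
  exact ciInf_le ⟨0, by rintro _ ⟨w, rfl⟩; exact norm_nonneg _⟩ (⟨y, h.1⟩ : K)

lemma IsProj.norm_sub_le (hK : Convex ℝ K) {x y x' y' : PlayerAction d} (h : IsProj K x y)
    (h' : IsProj K x' y') : ‖y - y'‖ ≤ ‖x - x'‖ := by
  have h1 := h.inner_le_zero hK h'.1
  have h2 := h'.inner_le_zero hK h.1
  -- Firm nonexpansiveness, the sum of the two obtuse-angle inequalities.
  have h3 : ‖y - y'‖ ^ 2 ≤ ⟪x - x', y - y'⟫ := by
    rw [← real_inner_self_eq_norm_sq]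
    have e : ⟪x - x', y - y'⟫ - ⟪y - y', y - y'⟫ = -⟪x - y, y' - y⟫ - ⟪x' - y', y - y'⟫ := by
      simp only [inner_sub_left, inner_sub_right]
      ring
    linarith
  have h4 := real_inner_le_norm (x - x') (y - y')
  by_contra! hlt
  have : 0 < ‖y - y'‖ := (norm_nonneg _).trans_lt hlt
  nlinarith

lemma isProj_self {y : PlayerAction d} (hy : y ∈ K) : IsProj K y y :=
  ⟨hy, fun z _ => by simp⟩

lemma exists_isProj (hK : IsCompact K) (hne : K.Nonempty) (x : PlayerAction d) :
    ∃ y, IsProj K x y := by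
  obtain ⟨y, hy, h⟩ := hK.exists_isMinOn hne (f := fun z => ‖x - z‖) (by fun_prop)
  exact ⟨y, hy, fun z hz => h hz⟩

lemma norm_sub_le_of_isProj {N : ℕ} {K : Fin N → Set (PlayerAction d)}
    (hK : ∀ i, Convex ℝ (K i)) {x y x' y' : Profile N d}
    (h : ∀ i, IsProj (K i) (x i) (y i)) (h' : ∀ i, IsProj (K i) (x' i) (y' i)) :
    ‖y - y'‖ ≤ ‖x - x'‖ := by
  rw [PiLp.norm_eq_of_L2, PiLp.norm_eq_of_L2]
  refine Real.sqrt_le_sqrt (Finset.sum_le_sum fun i _ => ?_)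
  exact pow_le_pow_left₀ (norm_nonneg _) ((h i).norm_sub_le (hK i) (h' i)) 2

end Proj

/-! ### Nash equilibria -/

section Nash

variable {N d : ℕ}

/-- The inclusion of the actions of player `i` as a block of the joint actions. -/
noncomputable def blockCLM (N d : ℕ) (i : Fin N) : PlayerAction d →L[ℝ] Profile N d :=
  (PiLp.continuousLinearEquiv 2 ℝ (fun _ : Fin N => PlayerAction d)).symm.toContinuousLinearMap.comp
    (ContinuousLinearMap.single ℝ (fun _ : Fin N => PlayerAction d) i)

lemma blockCLM_apply (i j : Fin N) (v : PlayerAction d) :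
    blockCLM N d i v j = if j = i then v else 0 := by
  simp only [blockCLM, ContinuousLinearMap.comp_apply]
  change (Pi.single i v : Fin N → PlayerAction d) j = _
  rw [Pi.single_apply]

lemma norm_blockCLM (i : Fin N) (v : PlayerAction d) : ‖blockCLM N d i v‖ = ‖v‖ := by
  rw [PiLp.norm_eq_of_L2, ← Real.sqrt_sq (norm_nonneg v)]
  congr 1
  rw [Finset.sum_eq_single i] <;> simp +contextual [blockCLM_apply]

lemma inner_blockCLM (i : Fin N) (x : Profile N d) (v : PlayerAction d) :
    ⟪x, blockCLM N d i v⟫ = ⟪x i, v⟫ := by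
  rw [PiLp.inner_apply, Finset.sum_eq_single i]
  · rw [blockCLM_apply, if_pos rfl]
  · intro j _ hj
    rw [blockCLM_apply, if_neg hj, inner_zero_right]
  · simp

lemma deviate_eq (x : Profile N d) (i : Fin N) (y : PlayerAction d) :
    deviate x i y = x + blockCLM N d i (y - x i) := by
  ext j : 1
  rw [PiLp.add_apply, blockCLM_apply]
  by_cases h : j = i
  · subst h; simp [deviate]
  · simp [deviate, h]

lemma deviate_self (x : Profile N d) (i : Fin N) : deviate x i (x i) = x := by
  simp [deviate_eq]

lemma hasFDerivAt_deviate {J : Profile N d → ℝ} (x : Profile N d) (i : Fin N)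
    (hJ : DifferentiableAt ℝ J x) :
    HasFDerivAt (fun y => J (deviate x i y)) ((fderiv ℝ J x).comp (blockCLM N d i)) (x i) := by
  have h1 : HasFDerivAt (fun y => deviate x i y) (blockCLM N d i) (x i) := by
    simp_rw [deviate_eq]
    exact ((blockCLM N d i).hasFDerivAt.comp (x i) ((hasFDerivAt_id _).sub_const _)).const_add x
  have h2 : HasFDerivAt J (fderiv ℝ J x) (deviate x i (x i)) := by
    rw [deviate_self]; exact hJ.hasFDerivAt
  exact h2.comp (x i) h1

namespace Game

variable {G : Game N d}

lemma inner_pseudoGradient_apply (hG : G.IsConvex) (x : Profile N d) (i : Fin N)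
    (v : PlayerAction d) :
    ⟪G.pseudoGradient x i, v⟫ = fderiv ℝ (G.J i) x (blockCLM N d i v) := by
  have h := hasFDerivAt_deviate x i ((hG.contDiff i).differentiable one_ne_zero x)
  change ⟪gradient (fun y => G.J i (deviate x i y)) (x i), v⟫ = _
  rw [inner_gradient_left, h.fderiv]
  rfl

lemma inner_pseudoGradient (hG : G.IsConvex) (x v : Profile N d) :
    ⟪G.pseudoGradient x, v⟫ = ∑ i, fderiv ℝ (G.J i) x (blockCLM N d i (v i)) := by
  rw [PiLp.inner_apply]
  exact Finset.sum_congr rfl fun i _ => inner_pseudoGradient_apply hG x i (v i)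

/-- The set of joint actions. -/
def joint (G : Game N d) : Set (Profile N d) := {x | ∀ i, x i ∈ G.A i}

lemma convex_joint (hG : G.IsConvex) : Convex ℝ G.joint :=
  fun _ hx _ hy _ _ hp hq hpq i => hG.convex i (hx i) (hy i) hp hq hpq

lemma isCompact_joint (hA : ∀ i, IsCompact (G.A i)) : IsCompact G.joint := by
  have h := isCompact_univ_pi hA
  have h2 := h.image (PiLp.continuousLinearEquiv 2 ℝ
    (fun _ : Fin N => PlayerAction d)).symm.continuous
  convert! h2 using 1
  ext x
  constructor
  · intro hx
    exact ⟨WithLp.ofLp x, fun i _ => hx i, rfl⟩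
  · rintro ⟨y, hy, rfl⟩ i
    exact hy i trivial

/-- Summing the players' first-order conditions gives the variational inequality. Conversely, a
deviation of a single player isolates one block, and convexity in the own action makes the
first-order condition sufficient. -/
lemma isNash_iff (hG : G.IsConvex) (x : Profile N d) :
    G.IsNash x ↔ x ∈ G.joint ∧ ∀ z ∈ G.joint, 0 ≤ ⟪G.pseudoGradient x, z - x⟫ := by
  have hd := fun i => hasFDerivAt_deviate x i ((hG.contDiff i).differentiable one_ne_zero x)
  constructor
  · rintro ⟨hx, h⟩
    refine ⟨hx, fun z hz => ?_⟩
    rw [inner_pseudoGradient hG]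
    refine Finset.sum_nonneg fun i _ => ?_
    have hmin : IsLocalMinOn (fun y => G.J i (deviate x i y)) (G.A i) (x i) := by
      refine IsMinOn.localize fun y hy => ?_
      change G.J i (deviate x i (x i)) ≤ _
      rw [deviate_self]
      exact h i y hy
    exact hmin.hasFDerivWithinAt_nonneg (hd i).hasFDerivWithinAt
      (sub_mem_posTangentConeAt_of_segment_subset ((hG.convex i).segment_subset (hx i) (hz i)))
  · rintro ⟨hx, h⟩
    refine ⟨hx, fun i y hy => ?_⟩
    have hz : deviate x i y ∈ G.joint := by
      intro j
      by_cases hj : j = i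
      · subst hj; simpa [deviate] using hy
      · simpa [deviate, hj] using hx j
    have h1 := h _ hz
    rw [deviate_eq, add_sub_cancel_left, inner_blockCLM, inner_pseudoGradient_apply hG] at h1
    have hl : HasDerivAt (fun τ : ℝ => G.J i (deviate x i (AffineMap.lineMap (x i) y τ)))
        (fderiv ℝ (G.J i) x (blockCLM N d i (y - x i))) 0 := by
      have h0 : HasFDerivAt (fun y => G.J i (deviate x i y))
          ((fderiv ℝ (G.J i) x).comp (blockCLM N d i)) (AffineMap.lineMap (x i) y (0 : ℝ)) := by
        rw [AffineMap.lineMap_apply_zero]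
        exact hd i
      exact h0.comp_hasDerivAt (0 : ℝ) AffineMap.hasDerivAt_lineMap
    have hcv := (hG.convexOn i x).comp_affineMap (AffineMap.lineMap (k := ℝ) (x i) y)
    -- The chord over `[0, 1]` is at least as steep as the tangent at `0`.
    have hs := hcv.le_slope_of_hasDerivAt (x := 0) (y := 1) trivial trivial one_pos hl
    rw [slope_def_field] at hs
    simp only [Function.comp_apply, AffineMap.lineMap_apply_one, AffineMap.lineMap_apply_zero,
      deviate_self, sub_zero, div_one] at hs
    linarith

lemma continuous_pseudoGradient (hG : G.IsConvex) : Continuous G.pseudoGradient := by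
  have hi : ∀ i, Continuous fun x => G.pseudoGradient x i := by
    intro i
    have e : (fun x => G.pseudoGradient x i) = fun x => (InnerProductSpace.toDual ℝ _).symm
        ((fderiv ℝ (G.J i) x).comp (blockCLM N d i)) := by
      ext x : 1
      refine ext_inner_right ℝ fun v => ?_
      rw [inner_pseudoGradient_apply hG, InnerProductSpace.toDual_symm_apply]
      rfl
    rw [e]
    exact (LinearIsometryEquiv.continuous _).comp
      (((hG.contDiff i).continuous_fderiv one_ne_zero).clm_comp continuous_const)
  exact (PiLp.continuous_toLp 2 _).comp (continuous_pi hi)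

lemma exists_isNash (hG : G.IsConvex) (hA : ∀ i, IsCompact (G.A i))
    (hne : ∀ i, (G.A i).Nonempty) {ν : ℝ} (hν : 0 ≤ ν) (hm : G.StronglyMonotone ν) :
    ∃ x, G.IsNash x := by
  choose x hx using hne
  obtain ⟨y, hy, h⟩ := exists_variational_inequality (isCompact_joint hA) (convex_joint hG)
    ⟨WithLp.toLp 2 x, hx⟩ (continuous_pseudoGradient hG)
    (fun x _ y _ => (mul_nonneg hν (sq_nonneg _)).trans (hm x y))
  exact ⟨y, (isNash_iff hG y).2 ⟨hy, h⟩⟩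

/-- The inner product of the pseudo-gradient with the direction to an equilibrium grows
quadratically. -/
lemma IsNash.le_inner (hG : G.IsConvex) {ν : ℝ} (hm : G.StronglyMonotone ν)
    {a x : Profile N d} (ha : G.IsNash a) (hx : x ∈ G.joint) :
    ν * ‖x - a‖ ^ 2 ≤ ⟪G.pseudoGradient x, x - a⟫ := by
  have h1 := ((isNash_iff hG a).1 ha).2 x hx
  have h2 := hm x a
  rw [inner_sub_left] at h2
  linarith

lemma IsNash.unique (hG : G.IsConvex) {ν : ℝ} (hν : 0 < ν) (hm : G.StronglyMonotone ν)
    {a x : Profile N d} (ha : G.IsNash a) (hx : G.IsNash x) : x = a := by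
  have h1 := ha.le_inner hG hm hx.1
  have h2 := ((isNash_iff hG x).1 hx).2 a ha.1
  rw [← neg_sub, inner_neg_right] at h2
  have h3 : ‖x - a‖ ^ 2 ≤ 0 := by
    by_contra! h
    have := mul_pos hν h
    linarith
  rw [← sub_eq_zero, ← norm_eq_zero]
  exact pow_eq_zero_iff two_ne_zero |>.1 (le_antisymm h3 (sq_nonneg _))

end Game

end Nash

/-! ### Drift and size of the two-point estimate -/

/-- Compactly supported costs that agree with the costs of the game on the joint actions, the
projection on the joint actions, a bound `B` for all the data, and the radius `ε` of a ball
contained in every action set. -/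
structure Surrogate {N d : ℕ} (G : Game N d) where
  f : Fin N → Profile N d → ℝ
  p : Profile N d → Profile N d
  B : ℝ
  ε : ℝ
  contDiff : ∀ i, ContDiff ℝ 1 (f i)
  hasCompactSupport : ∀ i, HasCompactSupport (f i)
  eq_on : ∀ i, ∀ x ∈ G.joint, f i x = G.J i x
  fderiv_eq_on : ∀ i, ∀ x ∈ G.joint, fderiv ℝ (f i) x = fderiv ℝ (G.J i) x
  isProj : ∀ x i, IsProj (G.A i) (x i) (p x i)
  B_nonneg : 0 ≤ B
  norm_le : ∀ x ∈ G.joint, ‖x‖ ≤ B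
  norm_pseudoGradient_le : ∀ x ∈ G.joint, ‖G.pseudoGradient x‖ ≤ B
  norm_fderiv_le : ∀ i x, ‖fderiv ℝ (f i) x‖ ≤ B
  abs_f_le : ∀ i x, |f i x| ≤ B
  ε_pos : 0 < ε
  ball_subset : ∀ i, Metric.closedBall 0 ε ⊆ G.A i

lemma exists_bound_finite {ι : Type*} [Finite ι] {Q : ι → ℝ → Prop}
    (hQ : ∀ i, ∃ C, ∀ C' ≥ C, Q i C') : ∃ C, ∀ i, ∀ C' ≥ C, Q i C' := by
  choose C hC using hQ
  obtain ⟨D, hD⟩ := (Set.finite_range C).bddAbove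
  exact ⟨D, fun i C' h => hC i C' ((hD ⟨i, rfl⟩).trans h)⟩

/-- Each cost is multiplied by a smooth bump equal to `1` near every joint action, so values and
derivatives are unchanged there, while compact support makes the bounds global. -/
lemma nonempty_surrogate {N d : ℕ} {G : Game N d} (hG : G.IsConvex)
    (hA : ∀ i, IsCompact (G.A i)) (h0 : ∀ i, (0 : PlayerAction d) ∈ interior (G.A i)) :
    Nonempty (Surrogate G) := by
  have hK := Game.isCompact_joint hA
  obtain ⟨B₁, hB₁⟩ := hK.exists_bound_of_continuousOn (f := fun x => x) continuousOn_id
  obtain ⟨B₂, hB₂⟩ := hK.exists_bound_of_continuousOn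
    (Game.continuous_pseudoGradient hG).continuousOn
  have hr : 0 < |B₁| + 1 := by positivity
  let χ : ContDiffBump (0 : Profile N d) := ⟨|B₁| + 1, |B₁| + 2, hr, by linarith⟩
  set f : Fin N → Profile N d → ℝ := fun i x => χ x * G.J i x with hf
  have hone : ∀ x ∈ G.joint, (χ : Profile N d → ℝ) =ᶠ[𝓝 x] 1 := fun x hx => by
    refine χ.eventuallyEq_one_of_mem_ball ?_
    rw [mem_ball_zero_iff]
    exact (hB₁ x hx).trans_lt ((le_abs_self _).trans_lt (lt_add_one _))
  have heq : ∀ i, ∀ x ∈ G.joint, f i =ᶠ[𝓝 x] G.J i := fun i x hx => by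
    filter_upwards [hone x hx] with y hy
    simp [hf, hy]
  have hcd : ∀ i, ContDiff ℝ 1 (f i) := fun i => χ.contDiff.mul (hG.contDiff i)
  have hcs : ∀ i, HasCompactSupport (f i) := fun i => χ.hasCompactSupport.mul_right
  obtain ⟨B₃, hB₃⟩ := exists_bound_finite (Q := fun i C => ∀ x, |f i x| ≤ C) fun i => by
    obtain ⟨C, hC⟩ := (hcd i).continuous.bounded_above_of_compact_support (hcs i)
    exact ⟨C, fun C' h x => (hC x).trans h⟩
  obtain ⟨B₄, hB₄⟩ := exists_bound_finite (Q := fun i C => ∀ x, ‖fderiv ℝ (f i) x‖ ≤ C)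
    fun i => by
      obtain ⟨C, hC⟩ := ((hcd i).continuous_fderiv one_ne_zero).bounded_above_of_compact_support
        ((hcs i).fderiv ℝ)
      exact ⟨C, fun C' h x => (hC x).trans h⟩
  have hne : ∀ i, (G.A i).Nonempty := fun i => ⟨0, interior_subset (h0 i)⟩
  choose q hq using fun i x => exists_isProj (hA i) (hne i) x
  -- Radii are encoded as inverses, so that a common small radius becomes a common large bound.
  obtain ⟨D, hD⟩ := exists_bound_finite
    (Q := fun i C => 0 < C → Metric.closedBall 0 C⁻¹ ⊆ G.A i) fun i => by
      obtain ⟨r, hr, hb⟩ := Metric.nhds_basis_closedBall.mem_iff.1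
        (mem_interior_iff_mem_nhds.1 (h0 i))
      refine ⟨r⁻¹, fun C hC hpos => (Metric.closedBall_subset_closedBall ?_).trans hb⟩
      exact inv_le_of_inv_le₀ hr hC
  refine ⟨⟨f, fun x => WithLp.toLp 2 fun i => q i (x i), max (max B₁ B₂) (max (max B₃ B₄) 0),
    (max D 1)⁻¹, hcd, hcs, fun i x hx => (heq i x hx).eq_of_nhds,
    fun i x hx => (heq i x hx).fderiv_eq, fun x i => hq i (x i), ?_, fun x hx => ?_,
    fun x hx => ?_, fun i => hB₄ i _ ?_, fun i => hB₃ i _ ?_, ?_, fun i => hD i _ ?_ ?_⟩⟩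
  · exact le_max_of_le_right (le_max_right _ _)
  · exact (hB₁ x hx).trans (le_max_of_le_left (le_max_left _ _))
  · exact (hB₂ x hx).trans (le_max_of_le_left (le_max_right _ _))
  · exact le_max_of_le_right (le_max_of_le_left (le_max_right _ _))
  · exact le_max_of_le_right (le_max_of_le_left (le_max_left _ _))
  · exact inv_pos.2 (lt_max_of_lt_right one_pos)
  · exact le_max_left _ _
  · exact lt_max_of_lt_right one_pos

namespace Surrogate

variable {N d : ℕ} {G : Game N d} (S : Surrogate G)

lemma p_mem (x : Profile N d) : S.p x ∈ G.joint := fun i => (S.isProj x i).1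

lemma norm_p_sub_le (hG : G.IsConvex) (x y : Profile N d) : ‖S.p x - S.p y‖ ≤ ‖x - y‖ :=
  norm_sub_le_of_isProj hG.convex (S.isProj x) (S.isProj y)

lemma continuous_p (hG : G.IsConvex) : Continuous S.p :=
  (LipschitzWith.of_dist_le_mul (K := 1) fun x y => by
    simpa [dist_eq_norm] using S.norm_p_sub_le hG x y).continuous

/-- Projections are unique, so the played action is a continuous function of the sample; no separate
measurability of the actions is needed. -/
lemma eq_p (hG : G.IsConvex) {x a : Profile N d} (h : ∀ i, IsProj (G.A i) (x i) (a i)) :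
    a = S.p x := by
  ext i : 1
  have := (h i).norm_sub_le (hG.convex i) (S.isProj x i)
  rw [sub_self, norm_zero, norm_le_zero_iff, sub_eq_zero] at this
  exact this

lemma p_eq_self (hG : G.IsConvex) {x : Profile N d} (hx : x ∈ G.joint) : S.p x = x :=
  (S.eq_p hG fun i => isProj_self (hx i)).symm

lemma abs_f_sub_le (i : Fin N) (x y : Profile N d) : |S.f i x - S.f i y| ≤ S.B * ‖x - y‖ :=
  convex_univ.norm_image_sub_le_of_norm_fderiv_le (𝕜 := ℝ)
    (fun z _ => (S.contDiff i).differentiable one_ne_zero z)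
    (fun z _ => S.norm_fderiv_le i z) trivial trivial

lemma zero_mem (S : Surrogate G) (i : Fin N) : (0 : PlayerAction d) ∈ G.A i :=
  S.ball_subset i (by simp [S.ε_pos.le])

/-- Points of the shrunk action sets stay in the action sets after a small perturbation. -/
lemma add_mem_joint (hG : G.IsConvex) {ρ : ℝ} (hρ : 0 < ρ) (hρ1 : ρ ≤ 1) {m w : Profile N d}
    (hm : ∀ i, m i ∈ (1 - ρ) • G.A i) (hw : ‖w‖ ≤ ρ * S.ε) : w + m ∈ G.joint := by
  intro i
  obtain ⟨y, hy, hym⟩ := hm i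
  have hwi : ρ⁻¹ • w i ∈ G.A i := by
    refine S.ball_subset i ?_
    rw [mem_closedBall_zero_iff, norm_smul, norm_inv, Real.norm_of_nonneg hρ.le,
      inv_mul_le_iff₀ hρ]
    exact (PiLp.norm_apply_le w i).trans hw
  -- The point is the convex combination of `ρ⁻¹ • w i`, in the inner ball, and of `y`, with weights
  -- `ρ` and `1 - ρ`.
  have := hG.convex i hwi hy hρ.le (sub_nonneg.2 hρ1) (by ring)
  rw [smul_smul, mul_inv_cancel₀ hρ.ne', one_smul] at this
  simp only [] at hym
  rw [hym] at this
  exact this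

lemma mem_joint (S : Surrogate G) (hG : G.IsConvex) {ρ : ℝ} (hρ : 0 < ρ) (hρ1 : ρ ≤ 1) {m : Profile N d}
    (hm : ∀ i, m i ∈ (1 - ρ) • G.A i) : m ∈ G.joint := by
  have := S.add_mem_joint hG hρ hρ1 hm (w := 0) (by simpa using mul_nonneg hρ.le S.ε_pos.le)
  simpa using this

/-- The two-point estimates of all players at the state `m`, as a function of the normalized
noise `z`. -/
noncomputable def estimate (σ : ℝ) (m z : Profile N d) : Profile N d :=
  WithLp.toLp 2 fun i => twoPointEstimate G σ m (σ • z + m) (S.p (σ • z + m)) i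

lemma estimate_apply {σ : ℝ} (hσ : σ ≠ 0) (m z : Profile N d) (i : Fin N) :
    S.estimate σ m z i = ((G.J i (S.p (σ • z + m)) - G.J i m) / σ) • z i := by
  change twoPointEstimate G σ m (σ • z + m) (S.p (σ • z + m)) i = _
  rw [twoPointEstimate, PiLp.add_apply, add_sub_cancel_right, PiLp.smul_apply, smul_smul]
  congr 1
  field_simp

lemma inner_estimate {σ : ℝ} (hσ : σ ≠ 0) (m z v : Profile N d) :
    ⟪S.estimate σ m z, v⟫ =
      ∑ i, (G.J i (S.p (σ • z + m)) - G.J i m) / σ * ⟪z, blockCLM N d i (v i)⟫ := by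
  rw [PiLp.inner_apply]
  refine Finset.sum_congr rfl fun i _ => ?_
  rw [S.estimate_apply hσ, inner_blockCLM, real_inner_smul_left]

lemma continuous_estimate (hG : G.IsConvex) (σ : ℝ) :
    Continuous (Function.uncurry (S.estimate σ)) := by
  refine (PiLp.continuous_toLp 2 _).comp (continuous_pi fun i => ?_)
  have hJ := (hG.contDiff i).continuous
  have hp := S.continuous_p hG
  unfold twoPointEstimate
  fun_prop

lemma measurable_estimate (hG : G.IsConvex) (σ : ℝ) :
    Measurable (Function.uncurry (S.estimate σ)) :=
  (S.continuous_estimate hG σ).measurable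

/-- Since `p` fixes `m` and is nonexpansive, the two cost evaluations are at distance at most `σ
‖z‖`. The Lipschitz bound then absorbs `1/σ`, and the moments do not blow up as `σ → 0`. -/
lemma norm_estimate_le (hG : G.IsConvex) {σ : ℝ} (hσ : 0 < σ) {m : Profile N d}
    (hm : m ∈ G.joint) (z : Profile N d) :
    ‖S.estimate σ m z‖ ≤ N * S.B * ‖z‖ ^ 2 := by
  have hi : ∀ i, ‖S.estimate σ m z i‖ ≤ S.B * ‖z‖ ^ 2 := by
    intro i
    rw [S.estimate_apply hσ.ne', norm_smul, Real.norm_eq_abs, abs_div, abs_of_pos hσ,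
      ← S.eq_on i _ (S.p_mem _), ← S.eq_on i m hm]
    have h1 := S.abs_f_sub_le i (S.p (σ • z + m)) m
    have h2 := S.norm_p_sub_le hG (σ • z + m) m
    rw [S.p_eq_self hG hm, add_sub_cancel_right, norm_smul, Real.norm_of_nonneg hσ.le] at h2
    have h3 : |S.f i (S.p (σ • z + m)) - S.f i m| / σ ≤ S.B * ‖z‖ := by
      rw [div_le_iff₀ hσ]
      calc _ ≤ S.B * (σ * ‖z‖) := h1.trans (mul_le_mul_of_nonneg_left h2 S.B_nonneg)
        _ = _ := by ring
    calc _ ≤ S.B * ‖z‖ * ‖z‖ := mul_le_mul h3 (PiLp.norm_apply_le z i) (norm_nonneg _)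
            (mul_nonneg S.B_nonneg (norm_nonneg _))
      _ = _ := by ring
  have hsum : S.estimate σ m z = ∑ i, blockCLM N d i (S.estimate σ m z i) := by
    ext j : 1
    rw [WithLp.ofLp_sum, Finset.sum_apply]
    simp [blockCLM_apply]
  rw [hsum]
  refine (norm_sum_le _ _).trans ?_
  simp_rw [norm_blockCLM]
  refine (Finset.sum_le_sum fun i _ => hi i).trans ?_
  simp [mul_assoc]

lemma integrable_inner_estimate (hG : G.IsConvex) {σ : ℝ} (hσ : 0 < σ) {m : Profile N d}
    (hm : m ∈ G.joint) (v : Profile N d) :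
    Integrable (fun z => ⟪S.estimate σ m z, v⟫) (stdGaussian (Profile N d)) := by
  have hc : Continuous fun z => S.estimate σ m z :=
    (S.continuous_estimate hG σ).uncurry_left m
  refine ((integrable_norm_pow_stdGaussian 2).const_mul (N * S.B * ‖v‖)).mono'
    (hc.inner continuous_const).aestronglyMeasurable (ae_of_all _ fun z => ?_)
  rw [Real.norm_eq_abs]
  calc _ ≤ ‖S.estimate σ m z‖ * ‖v‖ := abs_real_inner_le_norm _ _
    _ ≤ (N * S.B * ‖z‖ ^ 2) * ‖v‖ :=
      mul_le_mul_of_nonneg_right (S.norm_estimate_le hG hσ hm z) (norm_nonneg _)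
    _ = _ := by ring

/-- The difference of the two sides of the Stein identity for the surrogate costs. -/
noncomputable def steinDefect (σ : ℝ) (m v z : Profile N d) : ℝ :=
  ∑ i, ((S.f i (σ • z + m) - G.J i m) / σ * ⟪z, blockCLM N d i (v i)⟫ -
    fderiv ℝ (S.f i) (σ • z + m) (blockCLM N d i (v i)))

/-- The chain rule supplies the factor `σ` that cancels `1/σ`. The baseline `G.J i m` contributes
nothing because the Gaussian is centred. -/
lemma integral_steinDefect {σ : ℝ} (hσ : σ ≠ 0) (m v : Profile N d) :
    Integrable (S.steinDefect σ m v) (stdGaussian (Profile N d)) ∧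
      ∫ z, S.steinDefect σ m v z ∂stdGaussian (Profile N d) = 0 := by
  have hin : ∀ u : Profile N d, Integrable (fun z => ⟪z, u⟫) (stdGaussian (Profile N d)) :=
    fun u => IsGaussian.integrable_id.inner_const u
  have haff : Continuous fun z : Profile N d => σ • z + m := by fun_prop
  have h1 : ∀ i, Integrable (fun z => S.f i (σ • z + m) * ⟪z, blockCLM N d i (v i)⟫)
      (stdGaussian (Profile N d)) := fun i =>
    (hin _).bdd_mul ((S.contDiff i).continuous.comp haff).aestronglyMeasurable
      (ae_of_all _ fun z => S.abs_f_le i _)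
  have hcf : ∀ i, Continuous fun z => fderiv ℝ (S.f i) (σ • z + m) (blockCLM N d i (v i)) :=
    fun i => ((((S.contDiff i).continuous_fderiv one_ne_zero).comp haff).clm_apply
      continuous_const)
  have h2 : ∀ i, Integrable (fun z => fderiv ℝ (S.f i) (σ • z + m) (blockCLM N d i (v i)))
      (stdGaussian (Profile N d)) := fun i =>
    (integrable_const (S.B * ‖blockCLM N d i (v i)‖)).mono' (hcf i).aestronglyMeasurable
      (ae_of_all _ fun z => (ContinuousLinearMap.le_opNorm _ _).trans
        (mul_le_mul_of_nonneg_right (S.norm_fderiv_le i _) (norm_nonneg _)))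
  have h3 : ∀ i, ∫ z, S.f i (σ • z + m) * ⟪z, blockCLM N d i (v i)⟫ ∂stdGaussian (Profile N d) =
      σ * ∫ z, fderiv ℝ (S.f i) (σ • z + m) (blockCLM N d i (v i))
        ∂stdGaussian (Profile N d) := fun i =>
    integral_affine_mul_inner_stdGaussian hσ m _ (S.contDiff i) (S.hasCompactSupport i)
  have h4 : ∀ u : Profile N d, ∫ z, ⟪z, u⟫ ∂stdGaussian (Profile N d) = 0 := fun u => by
    simp_rw [real_inner_comm u]
    rw [integral_inner (f := fun z => z) IsGaussian.integrable_id, integral_id_stdGaussian, inner_zero_right]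
  have hterm : ∀ i, (fun z => (S.f i (σ • z + m) - G.J i m) / σ * ⟪z, blockCLM N d i (v i)⟫ -
      fderiv ℝ (S.f i) (σ • z + m) (blockCLM N d i (v i))) = fun z =>
      σ⁻¹ * (S.f i (σ • z + m) * ⟪z, blockCLM N d i (v i)⟫) -
        G.J i m / σ * ⟪z, blockCLM N d i (v i)⟫ -
        fderiv ℝ (S.f i) (σ • z + m) (blockCLM N d i (v i)) := fun i => by
    ext z; ring
  have h5 : ∀ i, Integrable (fun z => σ⁻¹ * (S.f i (σ • z + m) * ⟪z, blockCLM N d i (v i)⟫) -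
      G.J i m / σ * ⟪z, blockCLM N d i (v i)⟫) (stdGaussian (Profile N d)) := fun i =>
    ((h1 i).const_mul _).sub ((hin _).const_mul _)
  have hInt : ∀ i, Integrable (fun z => (S.f i (σ • z + m) - G.J i m) / σ *
      ⟪z, blockCLM N d i (v i)⟫ - fderiv ℝ (S.f i) (σ • z + m) (blockCLM N d i (v i)))
      (stdGaussian (Profile N d)) := fun i => by
    rw [hterm]
    exact (h5 i).sub (h2 i)
  refine ⟨integrable_finsetSum _ fun i _ => hInt i, ?_⟩
  unfold steinDefect
  rw [integral_finsetSum _ fun i _ => hInt i]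
  refine Finset.sum_eq_zero fun i _ => ?_
  rw [hterm, integral_sub (h5 i) (h2 i),
    integral_sub ((h1 i).const_mul _) ((hin _).const_mul _), integral_const_mul,
    integral_const_mul, h3, h4]
  field_simp
  ring

end Surrogate

/-! ### Lower bounds for the drift -/

namespace Surrogate

variable {N d : ℕ} {G : Game N d} (S : Surrogate G)

/-- The baselines cancel. The remaining comparison of the cost at the projected sample with the
surrogate at the sample vanishes when the sample is feasible. -/
lemma inner_estimate_sub_steinDefect {σ : ℝ} (hσ : σ ≠ 0) (m v z : Profile N d) :
    ⟪S.estimate σ m z, v⟫ - S.steinDefect σ m v z =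
      ∑ i, ((G.J i (S.p (σ • z + m)) - S.f i (σ • z + m)) / σ * ⟪z, blockCLM N d i (v i)⟫ +
        fderiv ℝ (S.f i) (σ • z + m) (blockCLM N d i (v i))) := by
  rw [S.inner_estimate hσ, steinDefect, ← Finset.sum_sub_distrib]
  exact Finset.sum_congr rfl fun i _ => by ring

/-- While the sample stays in the action sets, the corrected estimate is the pseudo-gradient at
the sample, to which strong monotonicity applies. -/
lemma le_inner_estimate_of_mem (hG : G.IsConvex) {ν : ℝ} (hν : 0 ≤ ν)
    (hmono : G.StronglyMonotone ν) {a : Profile N d} (ha : G.IsNash a) {σ ρ : ℝ} (hσ : 0 < σ)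
    (hρ : 0 ≤ ρ) {m z : Profile N d} (hm : m ∈ G.joint) (hx : σ • z + m ∈ G.joint) :
    ν * ‖m - a‖ ^ 2 - (S.B + 4 * ν * S.B) * (σ * ‖z‖) - ρ * S.B ^ 2 ≤
      ⟪S.estimate σ m z, m - (1 - ρ) • a⟫ - S.steinDefect σ m (m - (1 - ρ) • a) z := by
  have hsum : ⟪S.estimate σ m z, m - (1 - ρ) • a⟫ - S.steinDefect σ m (m - (1 - ρ) • a) z =
      ⟪G.pseudoGradient (σ • z + m), m - (1 - ρ) • a⟫ := by
    rw [S.inner_estimate_sub_steinDefect hσ.ne', Game.inner_pseudoGradient hG]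
    refine Finset.sum_congr rfl fun i _ => ?_
    rw [S.p_eq_self hG hx, S.eq_on i _ hx, S.fderiv_eq_on i _ hx, sub_self, zero_div, zero_mul,
      zero_add]
  rw [hsum]
  have hB := S.B_nonneg
  have h1 := ha.le_inner hG hmono hx
  have h2 := S.norm_pseudoGradient_le _ hx
  have hma : ‖m - a‖ ≤ 2 * S.B :=
    (norm_sub_le _ _).trans (by linarith [S.norm_le m hm, S.norm_le a ha.1])
  generalize G.pseudoGradient (σ • z + m) = M at *
  -- Strong monotonicity handles the first summand; the other two give the `σ` and `ρ` errors.
  have e : m - (1 - ρ) • a = (σ • z + m - a) - σ • z + ρ • a := by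
    rw [sub_smul, one_smul]; abel
  rw [e, inner_add_right, inner_sub_right, inner_smul_right, inner_smul_right]
  have h3 : ⟪M, z⟫ ≤ S.B * ‖z‖ := (real_inner_le_norm _ _).trans
    (mul_le_mul_of_nonneg_right h2 (norm_nonneg _))
  have h4 : -(S.B * S.B) ≤ ⟪M, a⟫ := by
    have := (abs_real_inner_le_norm M a).trans
      (mul_le_mul h2 (S.norm_le a ha.1) (norm_nonneg _) hB)
    exact (abs_le.1 this).1
  have h5 : ‖m - a‖ ^ 2 - 4 * S.B * (σ * ‖z‖) ≤ ‖σ • z + m - a‖ ^ 2 := by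
    rw [add_sub_assoc, norm_add_sq_real]
    have h6 := (abs_le.1 (abs_real_inner_le_norm (σ • z) (m - a))).1
    rw [norm_smul, Real.norm_of_nonneg hσ.le] at h6
    have h7 : σ * ‖z‖ * ‖m - a‖ ≤ σ * ‖z‖ * (2 * S.B) :=
      mul_le_mul_of_nonneg_left hma (by positivity)
    nlinarith [sq_nonneg ‖σ • z‖]
  have h8 := mul_le_mul_of_nonneg_left h5 hν
  have h9 := mul_le_mul_of_nonneg_left h3 hσ.le
  have h10 := mul_le_mul_of_nonneg_left h4 hρ
  linarith

/-- For infeasible samples only boundedness is available. The resulting `1/σ` is affordable because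
such samples are rare. -/
lemma neg_le_inner_estimate_sub {σ ρ : ℝ} (hσ : 0 < σ) (hρ : 0 ≤ ρ) (hρ1 : ρ ≤ 1)
    {a m : Profile N d} (ha : a ∈ G.joint) (hm : m ∈ G.joint) (z : Profile N d) :
    -(2 * N * S.B ^ 2 + 4 * N * S.B ^ 2 / σ * ‖z‖) ≤
      ⟪S.estimate σ m z, m - (1 - ρ) • a⟫ - S.steinDefect σ m (m - (1 - ρ) • a) z := by
  rw [S.inner_estimate_sub_steinDefect hσ.ne']
  have hB := S.B_nonneg
  set v := m - (1 - ρ) • a with hv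
  have hvB : ‖v‖ ≤ 2 * S.B := by
    refine (norm_sub_le _ _).trans ?_
    rw [norm_smul, Real.norm_of_nonneg (sub_nonneg.2 hρ1)]
    have : (1 - ρ) * ‖a‖ ≤ 1 * S.B :=
      mul_le_mul (by linarith) (S.norm_le a ha) (norm_nonneg _) zero_le_one
    linarith [S.norm_le m hm]
  have hterm : ∀ i, -(2 * S.B ^ 2 + 4 * S.B ^ 2 / σ * ‖z‖) ≤
      (G.J i (S.p (σ • z + m)) - S.f i (σ • z + m)) / σ * ⟪z, blockCLM N d i (v i)⟫ +
        fderiv ℝ (S.f i) (σ • z + m) (blockCLM N d i (v i)) := by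
    intro i
    have hb : ‖blockCLM N d i (v i)‖ ≤ 2 * S.B := by
      rw [norm_blockCLM]
      exact (PiLp.norm_apply_le v i).trans hvB
    have h1 : |G.J i (S.p (σ • z + m)) - S.f i (σ • z + m)| ≤ 2 * S.B := by
      rw [← S.eq_on i _ (S.p_mem _)]
      refine (abs_sub _ _).trans ?_
      linarith [S.abs_f_le i (S.p (σ • z + m)), S.abs_f_le i (σ • z + m)]
    have h2 : |⟪z, blockCLM N d i (v i)⟫| ≤ ‖z‖ * (2 * S.B) :=
      (abs_real_inner_le_norm _ _).trans (mul_le_mul_of_nonneg_left hb (norm_nonneg _))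
    have h3 : |(G.J i (S.p (σ • z + m)) - S.f i (σ • z + m)) / σ *
        ⟪z, blockCLM N d i (v i)⟫| ≤ 4 * S.B ^ 2 / σ * ‖z‖ := by
      rw [abs_mul, abs_div, abs_of_pos hσ]
      calc _ ≤ (2 * S.B / σ) * (‖z‖ * (2 * S.B)) :=
            mul_le_mul (div_le_div_of_nonneg_right h1 hσ.le) h2 (abs_nonneg _) (by positivity)
        _ = _ := by ring
    have h4 : |fderiv ℝ (S.f i) (σ • z + m) (blockCLM N d i (v i))| ≤ 2 * S.B ^ 2 := by
      calc _ ≤ ‖fderiv ℝ (S.f i) (σ • z + m)‖ * ‖blockCLM N d i (v i)‖ :=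
            ContinuousLinearMap.le_opNorm _ _
        _ ≤ S.B * (2 * S.B) := mul_le_mul (S.norm_fderiv_le i _) hb (norm_nonneg _) hB
        _ = _ := by ring
    linarith [(abs_le.1 h3).1, (abs_le.1 h4).1]
  refine le_trans (le_of_eq ?_) (Finset.sum_le_sum fun i _ => hterm i)
  simp only [Finset.sum_const, Finset.card_univ, Fintype.card_fin, nsmul_eq_mul]
  ring

/-- A pointwise Markov bound: infeasibility forces `σ ‖z‖ / (ρ' ε) > 1`, so its indicator is at most
the `k`-th power of this ratio. Here `ρ'` belongs to the round that produced `m`, and `ρ` to the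
current round. -/
lemma le_inner_estimate_sub (hG : G.IsConvex) {ν : ℝ} (hν : 0 ≤ ν)
    (hmono : G.StronglyMonotone ν) {a : Profile N d} (ha : G.IsNash a) {σ ρ ρ' : ℝ} (hσ : 0 < σ)
    (hρ : 0 ≤ ρ) (hρ1 : ρ ≤ 1) (hρ' : 0 < ρ') (hρ1' : ρ' ≤ 1) {m : Profile N d}
    (hm : ∀ i, m i ∈ (1 - ρ') • G.A i) (k : ℕ) (z : Profile N d) :
    ν * ‖m - a‖ ^ 2 - (S.B + 4 * ν * S.B) * (σ * ‖z‖) - ρ * S.B ^ 2 -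
      (2 * N * S.B ^ 2 + 4 * ν * S.B ^ 2 + 4 * N * S.B ^ 2 / σ * ‖z‖) *
        (σ * ‖z‖ / (ρ' * S.ε)) ^ k ≤
      ⟪S.estimate σ m z, m - (1 - ρ) • a⟫ - S.steinDefect σ m (m - (1 - ρ) • a) z := by
  have hB := S.B_nonneg
  have hε := S.ε_pos
  have hmj := S.mem_joint hG hρ' hρ1' hm
  have hc : 0 ≤ 2 * N * S.B ^ 2 + 4 * ν * S.B ^ 2 + 4 * N * S.B ^ 2 / σ * ‖z‖ := by positivity
  by_cases hx : σ • z + m ∈ G.joint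
  · have h1 := S.le_inner_estimate_of_mem hG hν hmono ha hσ hρ hmj hx
    have h2 := mul_nonneg hc (by positivity : 0 ≤ (σ * ‖z‖ / (ρ' * S.ε)) ^ k)
    linarith
  · have h1 := S.neg_le_inner_estimate_sub hσ hρ hρ1 ha.1 hmj z
    have hlt : ρ' * S.ε < σ * ‖z‖ := by
      by_contra! h
      refine hx (S.add_mem_joint hG hρ' hρ1' hm ?_)
      rwa [norm_smul, Real.norm_of_nonneg hσ.le]
    have hθ : 1 ≤ (σ * ‖z‖ / (ρ' * S.ε)) ^ k :=
      one_le_pow₀ ((one_le_div (by positivity)).2 hlt.le)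
    have h2 := mul_le_mul_of_nonneg_left hθ hc
    have hma : ‖m - a‖ ≤ 2 * S.B :=
      (norm_sub_le _ _).trans (by linarith [S.norm_le m hmj, S.norm_le a ha.1])
    have h3 : ν * ‖m - a‖ ^ 2 ≤ ν * (2 * S.B) ^ 2 :=
      mul_le_mul_of_nonneg_left (pow_le_pow_left₀ (norm_nonneg _) hma 2) hν
    have h4 : 0 ≤ (S.B + 4 * ν * S.B) * (σ * ‖z‖) := by positivity
    have h5 : 0 ≤ ρ * S.B ^ 2 := by positivity
    nlinarith

/-- On average over the noise, the estimate points away from the equilibrium, up to an error that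
is controlled by the standard deviation and the shrinking parameters. -/
lemma exists_drift_bound (hG : G.IsConvex) {ν : ℝ} (hν : 0 ≤ ν)
    (hmono : G.StronglyMonotone ν) {a : Profile N d} (ha : G.IsNash a) (k : ℕ) :
    ∃ C, 0 ≤ C ∧ ∀ σ ρ ρ' : ℝ, 0 < σ → σ ≤ 1 → 0 ≤ ρ → ρ ≤ 1 → 0 < ρ' → ρ' ≤ 1 →
      ∀ m : Profile N d, (∀ i, m i ∈ (1 - ρ') • G.A i) →
      ν * ‖m - a‖ ^ 2 - C * (σ + ρ + (σ / ρ') ^ k / σ) ≤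
        ∫ z, ⟪S.estimate σ m z, m - (1 - ρ) • a⟫ ∂stdGaussian (Profile N d) := by
  set E : ℕ → ℝ := fun j => ∫ z, ‖z‖ ^ j ∂stdGaussian (Profile N d) with hE
  have hE0 : ∀ j, 0 ≤ E j := fun j => integral_nonneg fun z => by positivity
  have hB := S.B_nonneg
  have hε := S.ε_pos
  set c₁ := (S.B + 4 * ν * S.B) * E 1
  set c₂ := S.B ^ 2
  set c₃ := (2 * N * S.B ^ 2 + 4 * ν * S.B ^ 2) * E k * (S.ε⁻¹) ^ k
  set c₄ := 4 * N * S.B ^ 2 * E (k + 1) * (S.ε⁻¹) ^ k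
  have hc₁ : 0 ≤ c₁ := mul_nonneg (by positivity) (hE0 _)
  have hc₂ : 0 ≤ c₂ := by positivity
  have hc₃ : 0 ≤ c₃ := mul_nonneg (mul_nonneg (by positivity) (hE0 _)) (by positivity)
  have hc₄ : 0 ≤ c₄ := mul_nonneg (mul_nonneg (by positivity) (hE0 _)) (by positivity)
  refine ⟨c₁ + c₂ + c₃ + c₄, by positivity, ?_⟩
  intro σ ρ ρ' hσ hσ1 hρ hρ1 hρ' hρ1' m hm
  have hmj := S.mem_joint hG hρ' hρ1' hm
  set v := m - (1 - ρ) • a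
  have hInt := S.integrable_inner_estimate hG hσ hmj v
  obtain ⟨hD, hD0⟩ := S.integral_steinDefect hσ.ne' m v
  have e1 : ∫ z, ⟪S.estimate σ m z, v⟫ ∂stdGaussian (Profile N d) =
      ∫ z, (⟪S.estimate σ m z, v⟫ - S.steinDefect σ m v z) ∂stdGaussian (Profile N d) := by
    rw [integral_sub hInt hD, hD0, sub_zero]
  set τ := σ / ρ' with hτ
  have hτ0 : 0 ≤ τ := by positivity
  set K₁ := (S.B + 4 * ν * S.B) * σ
  set K₂ := (2 * N * S.B ^ 2 + 4 * ν * S.B ^ 2) * (τ * S.ε⁻¹) ^ k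
  set K₃ := 4 * N * S.B ^ 2 / σ * (τ * S.ε⁻¹) ^ k
  have hq : ∀ z : Profile N d, (ν * ‖m - a‖ ^ 2 - ρ * S.B ^ 2) - K₁ * ‖z‖ ^ 1 - K₂ * ‖z‖ ^ k -
      K₃ * ‖z‖ ^ (k + 1) ≤ ⟪S.estimate σ m z, v⟫ - S.steinDefect σ m v z := by
    intro z
    refine le_trans (le_of_eq ?_) (S.le_inner_estimate_sub hG hν hmono ha hσ hρ hρ1 hρ' hρ1' hm k z)
    have : σ * ‖z‖ / (ρ' * S.ε) = τ * S.ε⁻¹ * ‖z‖ := by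
      rw [hτ]; field_simp
    rw [this, mul_pow]
    simp only [K₁, K₂, K₃]
    ring
  have hj : ∀ j, Integrable (fun z : Profile N d => ‖z‖ ^ j) (stdGaussian (Profile N d)) :=
    integrable_norm_pow_stdGaussian
  have i₁ : Integrable (fun z : Profile N d =>
      (ν * ‖m - a‖ ^ 2 - ρ * S.B ^ 2) - K₁ * ‖z‖ ^ 1) (stdGaussian (Profile N d)) :=
    (integrable_const _).sub ((hj 1).const_mul _)
  have i₂ : Integrable (fun z : Profile N d =>
      (ν * ‖m - a‖ ^ 2 - ρ * S.B ^ 2) - K₁ * ‖z‖ ^ 1 - K₂ * ‖z‖ ^ k)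
      (stdGaussian (Profile N d)) := i₁.sub ((hj k).const_mul _)
  have i₃ : Integrable (fun z : Profile N d =>
      (ν * ‖m - a‖ ^ 2 - ρ * S.B ^ 2) - K₁ * ‖z‖ ^ 1 - K₂ * ‖z‖ ^ k - K₃ * ‖z‖ ^ (k + 1))
      (stdGaussian (Profile N d)) := i₂.sub ((hj (k + 1)).const_mul _)
  have e2 : ∫ z : Profile N d, ((ν * ‖m - a‖ ^ 2 - ρ * S.B ^ 2) - K₁ * ‖z‖ ^ 1 - K₂ * ‖z‖ ^ k -
      K₃ * ‖z‖ ^ (k + 1)) ∂stdGaussian (Profile N d) =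
      (ν * ‖m - a‖ ^ 2 - ρ * S.B ^ 2) - K₁ * E 1 - K₂ * E k - K₃ * E (k + 1) := by
    rw [integral_sub i₂ ((hj (k + 1)).const_mul _), integral_sub i₁ ((hj k).const_mul _),
      integral_sub (integrable_const _) ((hj 1).const_mul _), integral_const_mul,
      integral_const_mul, integral_const_mul]
    simp [hE]
  have h1 := integral_mono i₃ (hInt.sub hD) hq
  rw [e2] at h1
  rw [e1]
  refine le_trans ?_ h1
  -- With `σ ≤ 1`, the tail term without `1/σ` is absorbed by the one with it.
  have hτσ : τ ^ k ≤ τ ^ k / σ := le_div_self (by positivity) hσ hσ1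
  have t1 : K₁ * E 1 = c₁ * σ := by simp only [K₁, c₁]; ring
  have t2 : K₂ * E k = c₃ * τ ^ k := by simp only [K₂, c₃, mul_pow]; ring
  have t3 : K₃ * E (k + 1) = c₄ * (τ ^ k / σ) := by simp only [K₃, c₄, mul_pow]; ring
  have t2' : c₃ * τ ^ k ≤ c₃ * (τ ^ k / σ) := mul_le_mul_of_nonneg_left hτσ hc₃
  rw [t1, t2, t3]
  have hs : 0 ≤ τ ^ k / σ := by positivity
  have u1 : c₁ * σ ≤ c₁ * (σ + ρ + τ ^ k / σ) := mul_le_mul_of_nonneg_left (by linarith) hc₁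
  have u2 : ρ * S.B ^ 2 ≤ c₂ * (σ + ρ + τ ^ k / σ) := by
    rw [mul_comm]
    exact mul_le_mul_of_nonneg_left (by linarith) hc₂
  have u3 : c₃ * (τ ^ k / σ) ≤ c₃ * (σ + ρ + τ ^ k / σ) :=
    mul_le_mul_of_nonneg_left (by linarith) hc₃
  have u4 : c₄ * (τ ^ k / σ) ≤ c₄ * (σ + ρ + τ ^ k / σ) :=
    mul_le_mul_of_nonneg_left (by linarith) hc₄
  linarith

end Surrogate

/-! ### One round of the algorithm -/

/-- The normalized noise of round `t`. -/
noncomputable def noise {Ω : Type*} {N d : ℕ} (σ : ℕ → ℝ) (μ ξ : ℕ → Ω → Profile N d) (t : ℕ)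
    (ω : Ω) : Profile N d :=
  (σ t)⁻¹ • (ξ t ω - μ t ω)

lemma abs_sq_norm_sub_sub_le {E : Type*} [NormedAddCommGroup E] [InnerProductSpace ℝ E] {B : ℝ}
    {x u : E} (hx : ‖x‖ ≤ B) (hu : ‖u‖ ≤ B) {p q : ℝ} (hp : 0 ≤ p) (hp1 : p ≤ 1) (hq : 0 ≤ q)
    (hq1 : q ≤ 1) : ‖x - p • u‖ ^ 2 ≤ ‖x - q • u‖ ^ 2 + 4 * B ^ 2 * |p - q| := by
  have hB : 0 ≤ B := (norm_nonneg _).trans hx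
  have h1 : ∀ s : ℝ, 0 ≤ s → s ≤ 1 → ‖x - s • u‖ ≤ 2 * B := fun s hs hs1 => by
    refine (norm_sub_le _ _).trans ?_
    rw [norm_smul, Real.norm_of_nonneg hs]
    nlinarith [norm_nonneg u]
  have h2 : ‖x - p • u‖ ≤ ‖x - q • u‖ + |p - q| * B := by
    have e : x - p • u = (x - q • u) - (p - q) • u := by rw [sub_smul]; abel
    rw [e]
    refine (norm_sub_le _ _).trans ?_
    rw [norm_smul, Real.norm_eq_abs]
    gcongr
  have h3 := h1 p hp hp1
  have h4 := h1 q hq hq1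
  nlinarith [norm_nonneg (x - p • u), norm_nonneg (x - q • u), abs_nonneg (p - q),
    mul_nonneg (abs_nonneg (p - q)) hB]

namespace IsRun

variable {Ω : Type*} [MeasurableSpace Ω] {P : Measure Ω} {N d : ℕ}
  {G : Game N d} {γ σ ρ : ℕ → ℝ} {μ ξ a : ℕ → Ω → Profile N d}

lemma state_mem (h : IsRun P G γ σ ρ μ ξ a) {t : ℕ} (ht : 1 ≤ t) (ω : Ω) (i : Fin N) :
    μ (t + 1) ω i ∈ (1 - ρ t) • G.A i :=
  (h.update t ht ω i).1

lemma isProj_update (h : IsRun P G γ σ ρ μ ξ a) (hG : G.IsConvex) (S : Surrogate G) {t : ℕ}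
    (ht : 1 ≤ t) (hσ : σ t ≠ 0) (ω : Ω) (i : Fin N) :
    IsProj ((1 - ρ t) • G.A i)
      ((μ t ω - γ t • S.estimate (σ t) (μ t ω) (noise σ μ ξ t ω)) i) (μ (t + 1) ω i) := by
  have e : σ t • noise σ μ ξ t ω + μ t ω = ξ t ω := by
    rw [noise, smul_smul, mul_inv_cancel₀ hσ, one_smul, sub_add_cancel]
  have := h.update t ht ω i
  rw [S.eq_p hG (h.action t ht ω)] at this
  rw [PiLp.sub_apply, PiLp.smul_apply, Surrogate.estimate, e]
  exact this

/-- A state that is feasible for the next projection moves by at most the step size times the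
estimate. -/
lemma norm_step_le (h : IsRun P G γ σ ρ μ ξ a) (hG : G.IsConvex) (S : Surrogate G) {t : ℕ}
    (ht : 1 ≤ t) (hσ : σ t ≠ 0) (hγ : 0 ≤ γ t) {ω : Ω} (hm : ∀ i, μ t ω i ∈ (1 - ρ t) • G.A i) :
    ‖μ (t + 1) ω - μ t ω‖ ≤ γ t * ‖S.estimate (σ t) (μ t ω) (noise σ μ ξ t ω)‖ := by
  refine (norm_sub_le_of_isProj (fun i => (hG.convex i).smul (1 - ρ t))
    (h.isProj_update hG S ht hσ ω) fun i => isProj_self (hm i)).trans ?_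
  rw [sub_sub_cancel_left, norm_neg, norm_smul, Real.norm_of_nonneg hγ]

/-- The reference point is shrunk because nonexpansiveness needs a fixed point of the projection on
`(1 - ρ t) • G.A i`. -/
lemma sq_norm_update_le (h : IsRun P G γ σ ρ μ ξ a) (hG : G.IsConvex) (S : Surrogate G) {t : ℕ}
    (ht : 1 ≤ t) (hσ : σ t ≠ 0) {x : Profile N d} (hx : x ∈ G.joint) (ω : Ω) :
    ‖μ (t + 1) ω - (1 - ρ t) • x‖ ^ 2 ≤ ‖μ t ω - (1 - ρ t) • x‖ ^ 2 -
      2 * γ t * ⟪S.estimate (σ t) (μ t ω) (noise σ μ ξ t ω), μ t ω - (1 - ρ t) • x⟫ +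
      γ t ^ 2 * ‖S.estimate (σ t) (μ t ω) (noise σ μ ξ t ω)‖ ^ 2 := by
  have h1 := norm_sub_le_of_isProj (fun i => (hG.convex i).smul (1 - ρ t))
    (h.isProj_update hG S ht hσ ω) (y' := (1 - ρ t) • x)
    fun i => isProj_self (Set.smul_mem_smul_set (hx i))
  refine (pow_le_pow_left₀ (norm_nonneg _) h1 2).trans (le_of_eq ?_)
  rw [sub_right_comm, norm_sub_sq_real, inner_smul_right, real_inner_comm, norm_smul, mul_pow,
    Real.norm_eq_abs, sq_abs]
  ring

lemma norm_state_le (h : IsRun P G γ σ ρ μ ξ a) (S : Surrogate G) {t : ℕ} (ht : 1 ≤ t) (ω : Ω) :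
    ‖μ (t + 1) ω‖ ≤ |1 - ρ t| * S.B := by
  choose y hy hyμ using h.state_mem ht ω
  have e : μ (t + 1) ω = (1 - ρ t) • (WithLp.toLp 2 y : Profile N d) := by
    ext i : 1
    exact (hyμ i).symm
  rw [e, norm_smul, Real.norm_eq_abs]
  exact mul_le_mul_of_nonneg_left (S.norm_le _ hy) (abs_nonneg _)

lemma measurable_noise (h : IsRun P G γ σ ρ μ ξ a) {t : ℕ} (ht : 1 ≤ t) :
    Measurable (noise σ μ ξ t) := by
  have := h.measurable_state t ht
  have := h.measurable_sample t ht
  unfold noise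
  fun_prop

variable [IsProbabilityMeasure P]

lemma integrable_sq_norm_state_sub (h : IsRun P G γ σ ρ μ ξ a) (S : Surrogate G) {t : ℕ}
    (ht : 1 ≤ t) (x : Profile N d) : Integrable (fun ω => ‖μ (t + 1) ω - x‖ ^ 2) P := by
  have hm := h.measurable_state (t + 1) (by omega)
  refine (integrable_const ((|1 - ρ t| * S.B + ‖x‖) ^ 2)).mono'
    (by fun_prop) (ae_of_all _ fun ω => ?_)
  rw [Real.norm_of_nonneg (sq_nonneg _)]
  refine pow_le_pow_left₀ (norm_nonneg _) ((norm_sub_le _ _).trans ?_) 2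
  gcongr
  exact h.norm_state_le S ht ω

lemma integrable_norm_noise_pow (h : IsRun P G γ σ ρ μ ξ a) {t : ℕ} (ht : 1 ≤ t) (hσ : σ t ≠ 0)
    (k : ℕ) : Integrable (fun ω => ‖noise σ μ ξ t ω‖ ^ k) P :=
  (h.measurePreserving_noise ht hσ).integrable_comp_of_integrable
    (integrable_norm_pow_stdGaussian k)

lemma integral_norm_noise_pow (h : IsRun P G γ σ ρ μ ξ a) {t : ℕ} (ht : 1 ≤ t) (hσ : σ t ≠ 0)
    (k : ℕ) : ∫ ω, ‖noise σ μ ξ t ω‖ ^ k ∂P =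
      ∫ z, ‖z‖ ^ k ∂stdGaussian (Profile N d) := by
  have hp := h.measurePreserving_noise ht hσ
  rw [← hp.map_eq, integral_map hp.aemeasurable (by fun_prop)]
  rfl

/-- The recursion for the mean squared distance to the shrunk equilibrium. -/
lemma integral_sq_norm_update_le (h : IsRun P G γ σ ρ μ ξ a) (hG : G.IsConvex) (S : Surrogate G)
    {ν : ℝ} (hν : 0 ≤ ν) {x : Profile N d} (hx : G.IsNash x) {C : ℝ} {k : ℕ}
    (hC : ∀ σ ρ ρ' : ℝ, 0 < σ → σ ≤ 1 → 0 ≤ ρ → ρ ≤ 1 → 0 < ρ' → ρ' ≤ 1 →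
      ∀ m : Profile N d, (∀ i, m i ∈ (1 - ρ') • G.A i) →
      ν * ‖m - x‖ ^ 2 - C * (σ + ρ + (σ / ρ') ^ k / σ) ≤
        ∫ z, ⟪S.estimate σ m z, m - (1 - ρ) • x⟫ ∂stdGaussian (Profile N d))
    {t : ℕ} (ht : 1 ≤ t) (hγ : 0 ≤ γ (t + 1)) (hσ : 0 < σ (t + 1)) (hσ1 : σ (t + 1) ≤ 1)
    (hρ : 0 ≤ ρ (t + 1)) (hρ1 : ρ (t + 1) ≤ 1) (hρ' : 0 < ρ t) (hρ1' : ρ t ≤ 1) :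
    ∫ ω, ‖μ (t + 2) ω - (1 - ρ (t + 1)) • x‖ ^ 2 ∂P ≤
      (1 - 2 * γ (t + 1) * ν) * ∫ ω, ‖μ (t + 1) ω - (1 - ρ t) • x‖ ^ 2 ∂P +
      (4 * S.B ^ 2 * |ρ t - ρ (t + 1)| + 2 * γ (t + 1) * (ν * (4 * S.B ^ 2 * ρ t) +
        C * (σ (t + 1) + ρ (t + 1) + (σ (t + 1) / ρ t) ^ k / σ (t + 1))) +
      γ (t + 1) ^ 2 * ((N * S.B) ^ 2 * ∫ z, ‖z‖ ^ 4 ∂stdGaussian (Profile N d))) := by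
  have ht' : 1 ≤ t + 1 := by omega
  have hB := S.B_nonneg
  have hm := h.measurable_state (t + 1) ht'
  have hn := h.measurable_noise ht'
  have hmem : ∀ ω, μ (t + 1) ω ∈ G.joint := fun ω =>
    S.mem_joint hG hρ' hρ1' (h.state_mem ht ω)
  set b := (1 - ρ (t + 1)) • x with hb
  set Q := fun ω => S.estimate (σ (t + 1)) (μ (t + 1) ω) (noise σ μ ξ (t + 1) ω) with hQ
  have hE := S.measurable_estimate hG (σ (t + 1))
  have hQm : Measurable Q := by fun_prop
  have hQn : ∀ ω, ‖Q ω‖ ≤ N * S.B * ‖noise σ μ ξ (t + 1) ω‖ ^ 2 := fun ω =>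
    S.norm_estimate_le hG hσ (hmem ω) _
  have hQ2 : ∀ ω, ‖Q ω‖ ^ 2 ≤ (N * S.B) ^ 2 * ‖noise σ μ ξ (t + 1) ω‖ ^ 4 := fun ω => by
    calc _ ≤ (N * S.B * ‖noise σ μ ξ (t + 1) ω‖ ^ 2) ^ 2 :=
          pow_le_pow_left₀ (norm_nonneg _) (hQn ω) 2
      _ = _ := by ring
  have hQi : Integrable (fun ω => ‖Q ω‖ ^ 2) P := by
    refine ((h.integrable_norm_noise_pow ht' hσ.ne' 4).const_mul ((N * S.B) ^ 2)).mono'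
      (by fun_prop) (ae_of_all _ fun ω => ?_)
    rw [Real.norm_of_nonneg (sq_nonneg _)]
    exact hQ2 ω
  have hQint : ∫ ω, ‖Q ω‖ ^ 2 ∂P ≤
      (N * S.B) ^ 2 * ∫ z, ‖z‖ ^ 4 ∂stdGaussian (Profile N d) := by
    rw [← h.integral_norm_noise_pow ht' hσ.ne', ← integral_const_mul]
    exact integral_mono hQi ((h.integrable_norm_noise_pow ht' hσ.ne' 4).const_mul _) hQ2
  have hxB := S.norm_le x hx.1
  have hvB : ∀ ω, ‖μ (t + 1) ω - b‖ ≤ 2 * S.B := fun ω => by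
    refine (norm_sub_le _ _).trans ?_
    rw [hb, norm_smul, Real.norm_of_nonneg (sub_nonneg.2 hρ1)]
    nlinarith [S.norm_le _ (hmem ω), norm_nonneg x]
  have hIi : Integrable (fun ω => ⟪Q ω, μ (t + 1) ω - b⟫) P := by
    refine ((h.integrable_norm_noise_pow ht' hσ.ne' 2).const_mul (N * S.B * (2 * S.B))).mono'
      (hQm.inner (hm.sub_const b)).aestronglyMeasurable (ae_of_all _ fun ω => ?_)
    rw [Real.norm_eq_abs]
    calc _ ≤ ‖Q ω‖ * ‖μ (t + 1) ω - b‖ := abs_real_inner_le_norm _ _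
      _ ≤ (N * S.B * ‖noise σ μ ξ (t + 1) ω‖ ^ 2) * (2 * S.B) :=
        mul_le_mul (hQn ω) (hvB ω) (norm_nonneg _) (by positivity)
      _ = _ := by ring
  set δ := C * (σ (t + 1) + ρ (t + 1) + (σ (t + 1) / ρ t) ^ k / σ (t + 1)) with hδ
  obtain ⟨hJi, hJ⟩ := h.integral_state_noise ht' hσ.ne'
    (g := fun m z => ⟪S.estimate (σ (t + 1)) m z, m - b⟫)
    (((S.continuous_estimate hG (σ (t + 1))).inner
      (continuous_fst.sub continuous_const)).measurable) hIi
  have hVi := h.integrable_sq_norm_state_sub S ht x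
  have hWi := h.integrable_sq_norm_state_sub S ht ((1 - ρ t) • x)
  have hUi := h.integrable_sq_norm_state_sub S ht b
  have hdrift : ν * ∫ ω, ‖μ (t + 1) ω - x‖ ^ 2 ∂P - δ ≤
      ∫ ω, ⟪Q ω, μ (t + 1) ω - b⟫ ∂P := by
    have e : ∫ ω, ⟪Q ω, μ (t + 1) ω - b⟫ ∂P = _ := hJ
    rw [e]
    have := integral_mono ((hVi.const_mul ν).sub (integrable_const δ)) hJi fun ω =>
      hC _ _ _ hσ hσ1 hρ hρ1 hρ' hρ1' (μ (t + 1) ω) (h.state_mem ht ω)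
    refine le_trans (le_of_eq ?_) this
    rw [integral_sub' (hVi.const_mul ν) (integrable_const δ), integral_const_mul]
    simp
  -- The drift involves the distance to `x` itself, the recursion the distance to the shrunk point.
  have hV : ∫ ω, ‖μ (t + 1) ω - (1 - ρ t) • x‖ ^ 2 ∂P - 4 * S.B ^ 2 * ρ t ≤
      ∫ ω, ‖μ (t + 1) ω - x‖ ^ 2 ∂P := by
    have := integral_mono hWi (hVi.add (integrable_const (4 * S.B ^ 2 * ρ t))) fun ω => by
      have := abs_sq_norm_sub_sub_le (S.norm_le _ (hmem ω)) hxB (sub_nonneg.2 hρ1')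
        (by linarith : 1 - ρ t ≤ 1) zero_le_one le_rfl
      rwa [one_smul, sub_sub_cancel_left, abs_neg, abs_of_pos hρ'] at this
    rw [integral_add' hVi (integrable_const _), integral_const] at this
    simp only [probReal_univ, one_smul] at this
    linarith
  -- The reference point moves from the shrinkage of round `t` to that of round `t + 1`.
  have hU : ∫ ω, ‖μ (t + 1) ω - b‖ ^ 2 ∂P ≤
      ∫ ω, ‖μ (t + 1) ω - (1 - ρ t) • x‖ ^ 2 ∂P + 4 * S.B ^ 2 * |ρ t - ρ (t + 1)| := by
    have := integral_mono hUi
      (hWi.add (integrable_const (4 * S.B ^ 2 * |ρ t - ρ (t + 1)|))) fun ω => by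
      have := abs_sq_norm_sub_sub_le (S.norm_le _ (hmem ω)) hxB (sub_nonneg.2 hρ1)
        (by linarith : 1 - ρ (t + 1) ≤ 1) (sub_nonneg.2 hρ1') (by linarith : 1 - ρ t ≤ 1)
      rwa [sub_sub_sub_cancel_left] at this
    rw [integral_add' hWi (integrable_const _), integral_const] at this
    simpa only [probReal_univ, one_smul] using this
  have hstep : ∫ ω, ‖μ (t + 2) ω - b‖ ^ 2 ∂P ≤ ∫ ω, ‖μ (t + 1) ω - b‖ ^ 2 ∂P -
      2 * γ (t + 1) * ∫ ω, ⟪Q ω, μ (t + 1) ω - b⟫ ∂P + γ (t + 1) ^ 2 * ∫ ω, ‖Q ω‖ ^ 2 ∂P := by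
    have := integral_mono (h.integrable_sq_norm_state_sub S ht' b)
      ((hUi.sub (hIi.const_mul (2 * γ (t + 1)))).add (hQi.const_mul (γ (t + 1) ^ 2)))
      fun ω => h.sq_norm_update_le hG S ht' hσ.ne' hx.1 ω
    refine this.trans (le_of_eq ?_)
    rw [integral_add' (hUi.sub (hIi.const_mul (2 * γ (t + 1)))) (hQi.const_mul (γ (t + 1) ^ 2)),
      integral_sub' hUi (hIi.const_mul (2 * γ (t + 1))), integral_const_mul, integral_const_mul]
  have f1 := mul_le_mul_of_nonneg_left hdrift (by positivity : 0 ≤ 2 * γ (t + 1))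
  have f2 := mul_le_mul_of_nonneg_left hV (by positivity : 0 ≤ 2 * γ (t + 1) * ν)
  have f3 := mul_le_mul_of_nonneg_left hQint (sq_nonneg (γ (t + 1)))
  linarith

end IsRun

/-! ### Rates -/

/-- Since `W` is nonnegative, `8` may be weakened to `2`. Then `C / T` with `C ≥ K` reproduces
itself, as `C (T - 1) / T² ≤ C / (T + 1)`; `n₀ ≥ 1` ensures `1 - 2 / T ≥ 0`. -/
lemma exists_le_div_of_recursion {W : ℕ → ℝ} (hW : ∀ n, 0 ≤ W n) {K : ℝ} {n₀ : ℕ}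
    (hn₀ : 1 ≤ n₀)
    (h : ∀ n ≥ n₀, W (n + 1) ≤ (1 - 8 / ((n : ℝ) + 1)) * W n + K / ((n : ℝ) + 1) ^ 2) :
    ∃ C, ∀ n ≥ n₀, W n ≤ C / ((n : ℝ) + 1) := by
  refine ⟨max K (max (W n₀ * (n₀ + 1)) 0), fun n hn => ?_⟩
  set C := max K (max (W n₀ * (n₀ + 1)) 0)
  have hCK : K ≤ C := le_max_left _ _
  have hC0 : 0 ≤ C := le_max_of_le_right (le_max_right _ _)
  induction n, hn using Nat.le_induction with
  | base =>
    rw [le_div_iff₀ (by positivity)]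
    exact le_max_of_le_right (le_max_left _ _)
  | succ n hn ih =>
    have hn1 : (1 : ℝ) ≤ n := by exact_mod_cast hn₀.trans hn
    refine (h n hn).trans ?_
    push_cast
    set T : ℝ := n + 1 with hT
    have hT2 : 2 ≤ T := by linarith
    have hT0 : 0 < T := by linarith
    have h2 : 8 / T ≥ 2 / T := by gcongr; norm_num
    have h3 : 0 ≤ 1 - 2 / T := by rw [sub_nonneg, div_le_one hT0]; exact hT2
    calc (1 - 8 / T) * W n + K / T ^ 2 ≤ (1 - 2 / T) * W n + K / T ^ 2 := by
          gcongr
          exact hW n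
      _ ≤ (1 - 2 / T) * (C / T) + C / T ^ 2 := by gcongr
      _ = C * (T - 1) / T ^ 2 := by field_simp; ring
      _ ≤ C / (T + 1) := by
          rw [div_le_div_iff₀ (by positivity) (by positivity), mul_assoc]
          refine mul_le_mul_of_nonneg_left ?_ hC0
          nlinarith

lemma div_rpow_le_div {b x s : ℝ} (hb : 0 ≤ b) (hx : 1 ≤ x) (hs : 1 ≤ s) : b / x ^ s ≤ b / x := by
  refine div_le_div_of_nonneg_left hb (by linarith) ?_
  simpa using Real.rpow_le_rpow_of_exponent_le hx hs

lemma div_rpow_antitone {c r x y : ℝ} (hc : 0 ≤ c) (hr : 0 ≤ r) (hx : 0 < x) (hxy : x ≤ y) :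
    c / y ^ r ≤ c / x ^ r :=
  div_le_div_of_nonneg_left hc (Real.rpow_pos_of_pos hx r) (Real.rpow_le_rpow hx.le hxy hr)

/-- Bernoulli's inequality for `(1 - 1/(x+1)) ^ r`. It makes the motion of the reference point
`O(1/t²)`. -/
lemma div_rpow_sub_div_rpow_le {c r x : ℝ} (hc : 0 ≤ c) (hr : 1 ≤ r) (hx : 1 ≤ x) :
    c / x ^ r - c / (x + 1) ^ r ≤ 2 * c * r / (x + 1) ^ 2 := by
  have hx0 : 0 < x := by linarith
  have hy0 : 0 < x + 1 := by linarith
  have hb := one_add_mul_self_le_rpow_one_add (s := -(x + 1)⁻¹)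
    (by rw [neg_le_neg_iff]; exact inv_le_one_of_one_le₀ (by linarith)) hr
  have e : 1 + -(x + 1)⁻¹ = x / (x + 1) := by field_simp; ring
  rw [e, Real.div_rpow hx0.le hy0.le] at hb
  have hxr : 0 < x ^ r := Real.rpow_pos_of_pos hx0 r
  have hyr : 0 < (x + 1) ^ r := Real.rpow_pos_of_pos hy0 r
  have h1 : c / x ^ r - c / (x + 1) ^ r = c / x ^ r * (1 - x ^ r / (x + 1) ^ r) := by
    field_simp
  have h2 : c / x ^ r ≤ 2 * c / (x + 1) := by
    refine (div_rpow_le_div hc hx hr).trans ?_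
    rw [div_le_div_iff₀ hx0 hy0]
    nlinarith
  have h3 : 1 - x ^ r / (x + 1) ^ r ≤ r / (x + 1) := by
    rw [div_eq_mul_inv r]; linarith
  rw [h1]
  calc _ ≤ c / x ^ r * (r / (x + 1)) := mul_le_mul_of_nonneg_left h3 (by positivity)
    _ ≤ 2 * c / (x + 1) * (r / (x + 1)) := mul_le_mul_of_nonneg_right h2 (by positivity)
    _ = _ := by field_simp

lemma ratio_pow_div_le {b c r s x y : ℝ} {k : ℕ} (hb : 0 < b) (hc : 0 < c) (hr : 0 ≤ r)
    (hk : s + 1 ≤ (s - r) * k) (hx : 0 < x) (hxy : x ≤ y) (hy : 1 ≤ y) :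
    (b / y ^ s / (c / x ^ r)) ^ k / (b / y ^ s) ≤ (b / c) ^ k / b / y := by
  have hy0 : 0 < y := by linarith
  have hys : 0 < y ^ s := Real.rpow_pos_of_pos hy0 s
  have hxr : 0 < x ^ r := Real.rpow_pos_of_pos hx r
  have h1 : b / y ^ s / (c / x ^ r) ≤ b / c * y ^ (r - s) := by
    rw [Real.rpow_sub hy0]
    have : x ^ r ≤ y ^ r := Real.rpow_le_rpow hx.le hxy hr
    calc _ = b / c * (x ^ r / y ^ s) := by field_simp
      _ ≤ _ := by gcongr
  calc _ ≤ (b / c * y ^ (r - s)) ^ k / (b / y ^ s) := by gcongr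
    _ = (b / c) ^ k / b * (y ^ ((r - s) * k) * y ^ s) := by
        rw [mul_pow, Real.rpow_mul_natCast hy0.le]; field_simp
    _ = (b / c) ^ k / b * y ^ ((r - s) * k + s) := by rw [Real.rpow_add hy0]
    _ ≤ (b / c) ^ k / b * y ^ (-1 : ℝ) := by
        gcongr
        linarith
    _ = _ := by rw [Real.rpow_neg_one]; rfl

section MeanSquare

variable {Ω : Type*} [MeasurableSpace Ω] {P : Measure Ω} [IsProbabilityMeasure P] {N d : ℕ}
  {G : Game N d} {μ ξ a : ℕ → Ω → Profile N d} {ν b c r s : ℝ}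

lemma exists_forall_div_rpow_le_one (hc : 0 ≤ c) (hr : 1 ≤ r) :
    ∃ n₀ : ℕ, 1 ≤ n₀ ∧ ∀ n ≥ n₀, c / (n : ℝ) ^ r ≤ 1 := by
  refine ⟨⌈c⌉₊ + 1, by omega, fun n hn => ?_⟩
  have h1 : (1 : ℝ) ≤ n := by exact_mod_cast (by omega : 1 ≤ n)
  refine (div_rpow_le_div hc h1 hr).trans ?_
  rw [div_le_one (by linarith)]
  exact (Nat.le_ceil c).trans (by exact_mod_cast (by omega : ⌈c⌉₊ ≤ n))

/-- The mean squared distance to the equilibrium is `O(1/t)`. -/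
lemma exists_integral_sq_norm_le (hG : G.IsConvex) (S : Surrogate G) (hν : 0 < ν)
    (hmono : G.StronglyMonotone ν) {x : Profile N d} (hx : G.IsNash x) (hb : 0 < b) (hc : 0 < c)
    (hr : 1 ≤ r) (hrs : r < s)
    (h : IsRun P G (fun t => 4 / (ν * (t : ℝ))) (fun t => b / (t : ℝ) ^ s)
      (fun t => c / (t : ℝ) ^ r) μ ξ a) :
    ∃ C, ∃ n₀ : ℕ, ∀ n ≥ n₀, ∫ ω, ‖μ (n + 1) ω - x‖ ^ 2 ∂P ≤ C / ((n : ℝ) + 1) := by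
  -- This `k` makes `(σ/ρ')^k / σ` of order `1/t`: the exponent `(r - s) k + s` is at most `-1`.
  obtain ⟨k, hk⟩ := exists_nat_ge ((s + 1) / (s - r))
  rw [div_le_iff₀ (by linarith), mul_comm] at hk
  obtain ⟨C, hC0, hC⟩ := S.exists_drift_bound hG hν.le hmono hx k
  obtain ⟨n₁, hn₁, hρ1⟩ := exists_forall_div_rpow_le_one hc.le hr
  obtain ⟨n₂, hn₂, hσ1⟩ := exists_forall_div_rpow_le_one hb.le (hr.trans hrs.le)
  set W : ℕ → ℝ := fun n => ∫ ω, ‖μ (n + 1) ω - (1 - c / (n : ℝ) ^ r) • x‖ ^ 2 ∂P with hW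
  set D := (N * S.B) ^ 2 * ∫ z, ‖z‖ ^ 4 ∂stdGaussian (Profile N d) with hD
  have hB := S.B_nonneg
  set K := 4 * S.B ^ 2 * (2 * c * r) + 8 / ν * (ν * (4 * S.B ^ 2 * (2 * c)) +
    C * (b + c + (b / c) ^ k / b)) + 16 / ν ^ 2 * D with hK
  have hrec : ∀ n ≥ max n₁ n₂, W (n + 1) ≤
      (1 - 8 / ((n : ℝ) + 1)) * W n + K / ((n : ℝ) + 1) ^ 2 := by
    intro n hn
    have hn1 : n₁ ≤ n := (le_max_left _ _).trans hn
    have hn2 : n₂ ≤ n := (le_max_right _ _).trans hn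
    have hnpos : 1 ≤ n := hn₁.trans hn1
    have hn' : (1 : ℝ) ≤ n := by exact_mod_cast hnpos
    have hn0 : (0 : ℝ) < n := by linarith
    have hT0 : (0 : ℝ) < (n : ℝ) + 1 := by linarith
    have hs1 := hσ1 (n + 1) (by omega)
    have hr1 := hρ1 (n + 1) (by omega)
    have hmain := h.integral_sq_norm_update_le hG S hν.le hx hC hnpos
      (by positivity) (by positivity) hs1 (by positivity) hr1 (by positivity) (hρ1 n hn1)
    refine hmain.trans ?_
    push_cast
    set T : ℝ := (n : ℝ) + 1 with hT
    have e1 : 2 * (4 / (ν * T)) * ν = 8 / T := by field_simp; ring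
    rw [e1]
    refine add_le_add le_rfl ?_
    have b1 : |c / (n : ℝ) ^ r - c / T ^ r| ≤ 2 * c * r / T ^ 2 := by
      rw [abs_of_nonneg (sub_nonneg.2 (div_rpow_antitone hc.le (by linarith) hn0 (by linarith)))]
      exact div_rpow_sub_div_rpow_le hc.le hr hn'
    have b2 : c / (n : ℝ) ^ r ≤ 2 * c / T := by
      refine (div_rpow_le_div hc.le hn' hr).trans ?_
      rw [div_le_div_iff₀ hn0 hT0]
      nlinarith
    have b3 : b / T ^ s ≤ b / T := div_rpow_le_div hb.le (by linarith) (by linarith)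
    have b4 : c / T ^ r ≤ c / T := div_rpow_le_div hc.le (by linarith) hr
    have b5 := ratio_pow_div_le hb hc (by linarith) hk hn0 (by linarith : (n : ℝ) ≤ T)
      (by linarith)
    calc _ ≤ 4 * S.B ^ 2 * (2 * c * r / T ^ 2) + 2 * (4 / (ν * T)) *
          (ν * (4 * S.B ^ 2 * (2 * c / T)) + C * (b / T + c / T + (b / c) ^ k / b / T)) +
          (4 / (ν * T)) ^ 2 * D := by gcongr
      _ = K / T ^ 2 := by rw [hK]; field_simp; ring
  obtain ⟨C', hC'⟩ := exists_le_div_of_recursion (W := W)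
    (fun n => integral_nonneg fun ω => sq_nonneg _) (hn₁.trans (le_max_left _ _)) hrec
  refine ⟨2 * C' + 2 * (2 * c) ^ 2 * ‖x‖ ^ 2, max n₁ n₂, fun n hn => ?_⟩
  have hnpos : 1 ≤ n := (hn₁.trans (le_max_left _ _)).trans hn
  have hn' : (1 : ℝ) ≤ n := by exact_mod_cast hnpos
  set T : ℝ := (n : ℝ) + 1 with hT
  have hT0 : 0 < T := by linarith
  set p := c / (n : ℝ) ^ r with hp
  have hp0 : 0 ≤ p := by positivity
  have hpT : p ≤ 2 * c / T := by
    refine (div_rpow_le_div hc.le hn' hr).trans ?_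
    rw [div_le_div_iff₀ (by linarith) hT0]
    nlinarith
  -- Return from the shrunk equilibrium to `x`, at the cost of `p² = O(1/T)`.
  have hpt : ∀ ω, ‖μ (n + 1) ω - x‖ ^ 2 ≤
      2 * ‖μ (n + 1) ω - (1 - p) • x‖ ^ 2 + 2 * p ^ 2 * ‖x‖ ^ 2 := fun ω => by
    have e : μ (n + 1) ω - x = (μ (n + 1) ω - (1 - p) • x) - p • x := by
      rw [sub_smul, one_smul]; abel
    have h1 : ‖μ (n + 1) ω - x‖ ≤ ‖μ (n + 1) ω - (1 - p) • x‖ + p * ‖x‖ := by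
      rw [e]
      refine (norm_sub_le _ _).trans ?_
      rw [norm_smul, Real.norm_of_nonneg hp0]
    calc _ ≤ (‖μ (n + 1) ω - (1 - p) • x‖ + p * ‖x‖) ^ 2 :=
          pow_le_pow_left₀ (norm_nonneg _) h1 2
      _ ≤ _ := by nlinarith [sq_nonneg (‖μ (n + 1) ω - (1 - p) • x‖ - p * ‖x‖)]
  have hWi := h.integrable_sq_norm_state_sub S hnpos ((1 - p) • x)
  have hi := integral_mono (h.integrable_sq_norm_state_sub S hnpos x)
    ((hWi.const_mul 2).add (integrable_const (2 * p ^ 2 * ‖x‖ ^ 2))) hpt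
  rw [integral_add' (hWi.const_mul 2) (integrable_const _), integral_const,
    integral_const_mul] at hi
  simp only [probReal_univ, one_smul] at hi
  have hWn : ∫ ω, ‖μ (n + 1) ω - (1 - p) • x‖ ^ 2 ∂P ≤ C' / T := hC' n hn
  have hp2 : p ^ 2 ≤ (2 * c) ^ 2 / T := by
    calc p ^ 2 ≤ (2 * c / T) ^ 2 := pow_le_pow_left₀ hp0 hpT 2
      _ = (2 * c) ^ 2 / T / T := by field_simp
      _ ≤ (2 * c) ^ 2 / T := div_le_self (by positivity) (by linarith)
  calc _ ≤ 2 * (C' / T) + 2 * ((2 * c) ^ 2 / T) * ‖x‖ ^ 2 := by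
        refine hi.trans (add_le_add (by linarith) ?_)
        gcongr
    _ = _ := by field_simp

end MeanSquare

/-! ### Almost sure convergence -/

/-- By Tonelli the series has finite expectation, hence converges almost surely. -/
lemma ae_tendsto_zero_of_summable_integral {Ω : Type*} [MeasurableSpace Ω] {P : Measure Ω}
    {X : ℕ → Ω → ℝ} (h0 : ∀ k ω, 0 ≤ X k ω) (hi : ∀ k, Integrable (X k) P)
    (hs : Summable fun k => ∫ ω, X k ω ∂P) :
    ∀ᵐ ω ∂P, Tendsto (fun k => X k ω) atTop (𝓝 0) := by
  have hm : ∀ k, AEMeasurable (fun ω => ENNReal.ofReal (X k ω)) P := fun k =>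
    (hi k).aemeasurable.ennreal_ofReal
  have hfin : ∫⁻ ω, ∑' k, ENNReal.ofReal (X k ω) ∂P ≠ ⊤ := by
    rw [lintegral_tsum hm]
    simp_rw [← fun k => ofReal_integral_eq_lintegral_ofReal (hi k) (ae_of_all _ (h0 k))]
    exact hs.tsum_ofReal_ne_top
  filter_upwards [ae_lt_top' (AEMeasurable.tsum hm) hfin] with ω hω
  have h1 := ENNReal.tendsto_atTop_zero_of_tsum_ne_top hω.ne
  have h2 := (ENNReal.tendsto_toReal ENNReal.zero_ne_top).comp h1
  simpa [Function.comp_def, ENNReal.toReal_ofReal (h0 _ ω)] using h2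

/-- As `ρ` decreases the shrunk sets grow, so each state is feasible for the next projection. -/
lemma smul_set_subset_of_le {E : Type*} [AddCommGroup E] [Module ℝ E] {K : Set E}
    (hK : Convex ℝ K) (h0 : (0 : E) ∈ K) {p q : ℝ} (hp : 0 ≤ p) (hpq : p ≤ q) :
    p • K ⊆ q • K := by
  rintro _ ⟨y, hy, rfl⟩
  rcases hp.eq_or_lt with rfl | hp'
  · exact ⟨0, h0, by simp⟩
  · have hq : 0 < q := hp'.trans_le hpq
    refine ⟨(p / q) • y, hK.smul_mem_of_zero_mem h0 hy
      ⟨by positivity, (div_le_one hq).2 hpq⟩, ?_⟩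
    simp only [smul_smul]
    rw [mul_div_cancel₀ _ hq.ne']

lemma tendsto_nat_sqrt_atTop : Tendsto Nat.sqrt atTop atTop :=
  tendsto_atTop_atTop.2 fun b => ⟨b * b, fun _ h => Nat.le_sqrt.2 h⟩

section Convergence

variable {Ω : Type*} [MeasurableSpace Ω] {P : Measure Ω} {N d : ℕ}
  {G : Game N d} {μ ξ a : ℕ → Ω → Profile N d} {ν b c r s : ℝ}

/-- Once the shrinking parameters are at most `1`, consecutive states are close. -/
lemma exists_norm_step_le (hG : G.IsConvex) (S : Surrogate G) (hν : 0 < ν) (hb : 0 < b)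
    (hc : 0 < c) (hr : 1 ≤ r)
    (h : IsRun P G (fun t => 4 / (ν * (t : ℝ))) (fun t => b / (t : ℝ) ^ s)
      (fun t => c / (t : ℝ) ^ r) μ ξ a) :
    ∃ n₀ : ℕ, ∀ n ≥ n₀, ∀ ω, ‖μ (n + 1) ω - μ n ω‖ ≤
      4 / (ν * (n : ℝ)) * (N * S.B * ‖noise (fun t => b / (t : ℝ) ^ s) μ ξ n ω‖ ^ 2) := by
  obtain ⟨n₁, hn₁, hρ1⟩ := exists_forall_div_rpow_le_one hc.le hr
  refine ⟨n₁ + 1, fun n hn ω => ?_⟩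
  -- State `m + 1` lies in the set shrunk by the parameter of round `m`, which must already be at
  -- most `1`.
  obtain ⟨m, rfl⟩ : ∃ m, n = m + 1 := ⟨n - 1, by omega⟩
  have hm : n₁ ≤ m := by omega
  have hm1 : 1 ≤ m := hn₁.trans hm
  have hm0 : (0 : ℝ) < m := by exact_mod_cast hm1
  have hσ : 0 < b / ((m + 1 : ℕ) : ℝ) ^ s := by positivity
  have hmem := h.state_mem hm1 ω
  have hnext : ∀ i, μ (m + 1) ω i ∈ (1 - c / ((m + 1 : ℕ) : ℝ) ^ r) • G.A i := fun i =>
    smul_set_subset_of_le (hG.convex i) (S.zero_mem i) (sub_nonneg.2 (hρ1 m hm))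
      (sub_le_sub_left (div_rpow_antitone hc.le (by linarith) hm0 (by push_cast; linarith)) 1)
      (hmem i)
  have hγ : 0 ≤ 4 / (ν * ((m + 1 : ℕ) : ℝ)) := by positivity
  refine (h.norm_step_le hG S (by omega) hσ.ne' hγ hnext).trans ?_
  refine mul_le_mul_of_nonneg_left (S.norm_estimate_le hG hσ ?_ _) hγ
  exact S.mem_joint hG (by positivity) (hρ1 m hm) hmem

variable [IsProbabilityMeasure P]

/-- The variation of the states between consecutive squares is square-summable in mean. -/
lemma integral_block_sq_le (hν : 0 < ν) (hb : 0 < b) {B : ℝ} (hB : 0 ≤ B)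
    (h : IsRun P G (fun t => 4 / (ν * (t : ℝ))) (fun t => b / (t : ℝ) ^ s)
      (fun t => c / (t : ℝ) ^ r) μ ξ a) {k : ℕ} (hk : 1 ≤ k) :
    Integrable (fun ω => (∑ t ∈ Finset.Ico (k * k) ((k + 1) * (k + 1)), 4 / (ν * (t : ℝ)) *
      (B * ‖noise (fun t => b / (t : ℝ) ^ s) μ ξ t ω‖ ^ 2)) ^ 2) P ∧
    ∫ ω, (∑ t ∈ Finset.Ico (k * k) ((k + 1) * (k + 1)), 4 / (ν * (t : ℝ)) *
      (B * ‖noise (fun t => b / (t : ℝ) ^ s) μ ξ t ω‖ ^ 2)) ^ 2 ∂P ≤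
      144 / ν ^ 2 * B ^ 2 * (∫ z, ‖z‖ ^ 4 ∂stdGaussian (Profile N d)) / (k : ℝ) ^ 2 := by
  set I := Finset.Ico (k * k) ((k + 1) * (k + 1)) with hI
  set Z := noise (fun t => b / (t : ℝ) ^ s) μ ξ with hZ
  set E₄ := ∫ z, ‖z‖ ^ 4 ∂stdGaussian (Profile N d)
  have hE₄ : 0 ≤ E₄ := integral_nonneg fun z => by positivity
  have hk0 : (1 : ℝ) ≤ k := by exact_mod_cast hk
  have ht1 : ∀ t ∈ I, 1 ≤ t := fun t ht =>
    (Nat.mul_le_mul hk hk).trans (Finset.mem_Ico.1 ht).1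
  have htk : ∀ t ∈ I, (k : ℝ) ^ 2 ≤ t := fun t ht => by
    rw [sq]; exact_mod_cast (Finset.mem_Ico.1 ht).1
  have hσ : ∀ t ∈ I, b / (t : ℝ) ^ s ≠ 0 := fun t ht => by
    have : (0 : ℝ) < t := by exact_mod_cast ht1 t ht
    positivity
  have hm : ∀ t ∈ I, Measurable (Z t) := fun t ht => h.measurable_noise (ht1 t ht)
  have hInt : ∀ t ∈ I, Integrable (fun ω => ‖Z t ω‖ ^ 4) P := fun t ht =>
    h.integrable_norm_noise_pow (ht1 t ht) (hσ t ht) 4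
  have hcard : (I.card : ℝ) ≤ 3 * k := by
    have : I.card = 2 * k + 1 := by rw [hI, Nat.card_Ico]; grind
    rw [this]; push_cast; linarith
  -- Cauchy–Schwarz costs one factor `3k` and the sum another, against squared steps of order
  -- `1/k⁴`; hence `144 = 9 * 16` and the order `1/k²`.
  have hpt : ∀ ω, (∑ t ∈ I, 4 / (ν * (t : ℝ)) * (B * ‖Z t ω‖ ^ 2)) ^ 2 ≤
      ∑ t ∈ I, 3 * k * (16 / ν ^ 2 * B ^ 2 / (k : ℝ) ^ 4) * ‖Z t ω‖ ^ 4 := fun ω => by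
    refine (sq_sum_le_card_mul_sum_sq (s := I)).trans ?_
    rw [Finset.mul_sum]
    refine Finset.sum_le_sum fun t ht => ?_
    have hkt := htk t ht
    calc _ ≤ 3 * k * (4 / (ν * (k : ℝ) ^ 2) * (B * ‖Z t ω‖ ^ 2)) ^ 2 := by gcongr
      _ = _ := by field_simp; ring
  have hSi : Integrable (fun ω => ∑ t ∈ I, 3 * k * (16 / ν ^ 2 * B ^ 2 / (k : ℝ) ^ 4) *
      ‖Z t ω‖ ^ 4) P := integrable_finsetSum _ fun t ht => (hInt t ht).const_mul _
  have hXi : Integrable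
      (fun ω => (∑ t ∈ I, 4 / (ν * (t : ℝ)) * (B * ‖Z t ω‖ ^ 2)) ^ 2) P := by
    refine hSi.mono' ?_ (ae_of_all _ fun ω => ?_)
    · refine Measurable.aestronglyMeasurable ((Finset.measurable_sum _ fun t ht => ?_).pow_const 2)
      exact (((hm t ht).norm.pow_const 2).const_mul _).const_mul _
    · rw [Real.norm_of_nonneg (sq_nonneg _)]
      exact hpt ω
  refine ⟨hXi, (integral_mono hXi hSi hpt).trans ?_⟩
  rw [integral_finsetSum _ fun t ht => (hInt t ht).const_mul _]
  have e : ∀ t ∈ I, ∫ ω, 3 * k * (16 / ν ^ 2 * B ^ 2 / (k : ℝ) ^ 4) * ‖Z t ω‖ ^ 4 ∂P =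
      3 * k * (16 / ν ^ 2 * B ^ 2 / (k : ℝ) ^ 4) * E₄ := fun t ht => by
    rw [integral_const_mul, h.integral_norm_noise_pow (ht1 t ht) (hσ t ht)]
  rw [Finset.sum_congr rfl e, Finset.sum_const, nsmul_eq_mul]
  calc _ ≤ 3 * k * (3 * k * (16 / ν ^ 2 * B ^ 2 / (k : ℝ) ^ 4) * E₄) := by gcongr
    _ = _ := by field_simp; ring

/-- `X k` collects the squared distance at time `k²` and the squared variation up to time `(k+1)²`.
Its means are `O(1/k²)`, so `X k → 0` almost surely, and it controls every `t` with `Nat.sqrt t =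
k`. -/
lemma ae_tendsto_state (hG : G.IsConvex) (S : Surrogate G) (hν : 0 < ν) (hb : 0 < b)
    (hc : 0 < c) (hr : 1 ≤ r)
    (h : IsRun P G (fun t => 4 / (ν * (t : ℝ))) (fun t => b / (t : ℝ) ^ s)
      (fun t => c / (t : ℝ) ^ r) μ ξ a) {x : Profile N d} {C : ℝ} {n₀ : ℕ}
    (hC : ∀ n ≥ n₀, ∫ ω, ‖μ (n + 1) ω - x‖ ^ 2 ∂P ≤ C / ((n : ℝ) + 1)) :
    ∀ᵐ ω ∂P, Tendsto (fun t => μ t ω) atTop (𝓝 x) := by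
  obtain ⟨n₁, hstep⟩ := exists_norm_step_le hG S hν hb hc hr h
  set k₀ := max n₀ n₁ + 2 with hk₀
  set Y : ℕ → Ω → ℝ := fun k ω => ∑ t ∈ Finset.Ico (k * k) ((k + 1) * (k + 1)),
    4 / (ν * (t : ℝ)) * (N * S.B * ‖noise (fun t => b / (t : ℝ) ^ s) μ ξ t ω‖ ^ 2) with hY
  have hY0 : ∀ k ω, 0 ≤ Y k ω := fun k ω => Finset.sum_nonneg fun t _ => by
    have := S.B_nonneg
    positivity
  set X : ℕ → Ω → ℝ := fun k ω => ‖μ (k * k) ω - x‖ ^ 2 + Y k ω ^ 2 with hX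
  set E₄ := ∫ z, ‖z‖ ^ 4 ∂stdGaussian (Profile N d)
  have hB : 0 ≤ N * S.B := mul_nonneg (Nat.cast_nonneg _) S.B_nonneg
  have hXb : ∀ k ≥ k₀, Integrable (X k) P ∧
      ∫ ω, X k ω ∂P ≤ (C + 144 / ν ^ 2 * (N * S.B) ^ 2 * E₄) * (1 / (k : ℝ) ^ 2) := by
    intro k hk
    obtain ⟨hYi, hYb⟩ := integral_block_sq_le hν hb hB h (by omega : 1 ≤ k)
    obtain ⟨n, hn⟩ : ∃ n, k * k = n + 1 := ⟨k * k - 1, by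
      have : 1 ≤ k * k := Nat.mul_pos (by omega) (by omega)
      omega⟩
    have hkk : 2 * k ≤ k * k := Nat.mul_le_mul_right k (by omega)
    have hVi := h.integrable_sq_norm_state_sub S (by omega : 1 ≤ n) x
    have hV := hC n (by omega)
    rw [← hn] at hVi hV
    have e : (n : ℝ) + 1 = (k : ℝ) ^ 2 := by rw [sq]; exact_mod_cast hn.symm
    rw [e] at hV
    refine ⟨hVi.add hYi, ?_⟩
    have e2 : ∫ ω, X k ω ∂P = ∫ ω, ‖μ (k * k) ω - x‖ ^ 2 ∂P + ∫ ω, Y k ω ^ 2 ∂P :=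
      integral_add hVi hYi
    rw [e2]
    refine (add_le_add hV hYb).trans (le_of_eq ?_)
    ring
  have hX0 : ∀ k ω, 0 ≤ X k ω := fun k ω => by positivity
  have hsum : Summable fun j => ∫ ω, X (j + k₀) ω ∂P := by
    refine Summable.of_nonneg_of_le (fun j => integral_nonneg (hX0 _))
      (fun j => (hXb (j + k₀) (by omega)).2) (Summable.mul_left _ ?_)
    exact (summable_nat_add_iff (f := fun k : ℕ => 1 / (k : ℝ) ^ 2) k₀).2
      (Real.summable_one_div_nat_pow.2 one_lt_two)
  have hae := ae_tendsto_zero_of_summable_integral (fun j => hX0 (j + k₀))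
    (fun j => (hXb (j + k₀) (by omega)).1) hsum
  filter_upwards [hae] with ω hω
  have hω' : Tendsto (fun k => X k ω) atTop (𝓝 0) :=
    (tendsto_add_atTop_iff_nat (f := fun k => X k ω) k₀).1 hω
  have hlim : Tendsto (fun t => 2 * √(X (Nat.sqrt t) ω)) atTop (𝓝 0) := by
    have := ((Real.continuous_sqrt.tendsto 0).comp (hω'.comp tendsto_nat_sqrt_atTop)).const_mul 2
    simpa [Function.comp_def] using this
  rw [tendsto_iff_norm_sub_tendsto_zero]
  refine squeeze_zero' (Eventually.of_forall fun t => norm_nonneg _) ?_ hlim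
  filter_upwards [tendsto_nat_sqrt_atTop.eventually_ge_atTop k₀] with t ht
  set k := Nat.sqrt t with hk
  have hkt : k * k ≤ t := Nat.sqrt_le t
  have htk : t ≤ (k + 1) * (k + 1) := (Nat.lt_succ_sqrt t).le
  have hkk : k ≤ k * k := Nat.le_mul_self k
  have hd : ‖μ t ω - μ (k * k) ω‖ ≤ Y k ω := by
    rw [← dist_eq_norm, dist_comm]
    refine (dist_le_Ico_sum_dist (fun j => μ j ω) hkt).trans ?_
    refine (Finset.sum_le_sum fun j hj => ?_).trans
      (Finset.sum_le_sum_of_subset_of_nonneg (Finset.Ico_subset_Ico_right htk) fun j _ _ => ?_)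
    · rw [dist_comm, dist_eq_norm]
      exact hstep j (by have := (Finset.mem_Ico.1 hj).1; omega) ω
    · have := S.B_nonneg
      positivity
  have h1 : ‖μ (k * k) ω - x‖ ≤ √(X k ω) :=
    Real.le_sqrt_of_sq_le (le_add_of_nonneg_right (sq_nonneg _))
  have h2 : Y k ω ≤ √(X k ω) :=
    Real.le_sqrt_of_sq_le (le_add_of_nonneg_left (sq_nonneg _))
  calc ‖μ t ω - x‖ = ‖(μ t ω - μ (k * k) ω) + (μ (k * k) ω - x)‖ := by rw [sub_add_sub_cancel]
    _ ≤ Y k ω + ‖μ (k * k) ω - x‖ := (norm_add_le _ _).trans (add_le_add hd le_rfl)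
    _ ≤ _ := by linarith

/-! ### Convergence of the samples in probability -/

/-- The sample is the state plus noise of size `σ_t → 0`, so it converges in mean square, and
Chebyshev's inequality applies. -/
lemma tendstoInMeasure_sample (S : Surrogate G) (hb : 0 < b) (hs : 1 ≤ s) {γ ρ : ℕ → ℝ}
    (h : IsRun P G γ (fun t => b / (t : ℝ) ^ s) ρ μ ξ a) {x : Profile N d} {C : ℝ} {n₀ : ℕ}
    (hC : ∀ n ≥ n₀, ∫ ω, ‖μ (n + 1) ω - x‖ ^ 2 ∂P ≤ C / ((n : ℝ) + 1)) :
    TendstoInMeasure P ξ atTop (fun _ => x) := by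
  set E₂ := ∫ z, ‖z‖ ^ 2 ∂stdGaussian (Profile N d)
  have hE₂ : 0 ≤ E₂ := integral_nonneg fun z => by positivity
  have hmean : ∀ n ≥ n₀ + 1, Integrable (fun ω => ‖ξ (n + 1) ω - x‖ ^ 2) P ∧
      ∫ ω, ‖ξ (n + 1) ω - x‖ ^ 2 ∂P ≤ (2 * b ^ 2 * E₂ + 2 * C) * (1 / ((n : ℝ) + 1)) := by
    intro n hn
    set T : ℝ := (n : ℝ) + 1 with hT
    have hT1 : 1 ≤ T := by simp [hT]
    set q := b / T ^ s with hq
    have hq0 : 0 < q := by positivity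
    have hqT : q ^ 2 ≤ b ^ 2 / T := by
      have : q ≤ b / T := div_rpow_le_div hb.le hT1 hs
      calc q ^ 2 ≤ (b / T) ^ 2 := pow_le_pow_left₀ hq0.le this 2
        _ = b ^ 2 / T / T := by field_simp
        _ ≤ b ^ 2 / T := div_le_self (by positivity) hT1
    have hcast : b / ((n + 1 : ℕ) : ℝ) ^ s = q := by rw [hq, hT]; push_cast; rfl
    have hne : b / ((n + 1 : ℕ) : ℝ) ^ s ≠ 0 := by rw [hcast]; exact hq0.ne'
    set Z := noise (fun t => b / (t : ℝ) ^ s) μ ξ (n + 1) with hZ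
    have hZi : Integrable (fun ω => ‖Z ω‖ ^ 2) P :=
      h.integrable_norm_noise_pow (by omega) hne 2
    have hZe : ∫ ω, ‖Z ω‖ ^ 2 ∂P = E₂ := h.integral_norm_noise_pow (by omega) hne 2
    have hVi := h.integrable_sq_norm_state_sub S (by omega : 1 ≤ n) x
    have hpt : ∀ ω, ‖ξ (n + 1) ω - x‖ ^ 2 ≤
        2 * q ^ 2 * ‖Z ω‖ ^ 2 + 2 * ‖μ (n + 1) ω - x‖ ^ 2 := fun ω => by
      have e : ξ (n + 1) ω - x = q • Z ω + (μ (n + 1) ω - x) := by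
        simp only [hZ, noise, hcast]
        rw [smul_smul, mul_inv_cancel₀ hq0.ne', one_smul, sub_add_sub_cancel]
      have h1 : ‖ξ (n + 1) ω - x‖ ≤ q * ‖Z ω‖ + ‖μ (n + 1) ω - x‖ := by
        rw [e]
        refine (norm_add_le _ _).trans ?_
        rw [norm_smul, Real.norm_of_nonneg hq0.le]
      calc _ ≤ (q * ‖Z ω‖ + ‖μ (n + 1) ω - x‖) ^ 2 := pow_le_pow_left₀ (norm_nonneg _) h1 2
        _ ≤ _ := by nlinarith [sq_nonneg (q * ‖Z ω‖ - ‖μ (n + 1) ω - x‖)]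
    have hbi := (hZi.const_mul (2 * q ^ 2)).add (hVi.const_mul 2)
    have hξ := h.measurable_sample (n + 1) (by omega)
    have hξi : Integrable (fun ω => ‖ξ (n + 1) ω - x‖ ^ 2) P := by
      refine hbi.mono' (by fun_prop) (ae_of_all _ fun ω => ?_)
      rw [Real.norm_of_nonneg (sq_nonneg _)]
      exact hpt ω
    refine ⟨hξi, (integral_mono hξi hbi hpt).trans ?_⟩
    rw [integral_add' (hZi.const_mul (2 * q ^ 2)) (hVi.const_mul 2), integral_const_mul,
      integral_const_mul, hZe]
    calc _ ≤ 2 * (b ^ 2 / T) * E₂ + 2 * (C / T) := by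
          gcongr
          exact hC n (by omega)
      _ = _ := by ring
  rw [tendstoInMeasure_iff_measureReal_norm]
  intro ε hε
  rw [← tendsto_add_atTop_iff_nat 1]
  have hlim : Tendsto (fun n : ℕ => (2 * b ^ 2 * E₂ + 2 * C) * (1 / ((n : ℝ) + 1)) / ε ^ 2) atTop
      (𝓝 0) := by
    simpa using (tendsto_one_div_add_atTop_nhds_zero_nat.const_mul
      (2 * b ^ 2 * E₂ + 2 * C)).div_const (ε ^ 2)
  refine squeeze_zero' (Eventually.of_forall fun n => measureReal_nonneg) ?_ hlim
  filter_upwards [eventually_ge_atTop (n₀ + 1)] with n hn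
  obtain ⟨hi, hle⟩ := hmean n hn
  rw [le_div_iff₀ (by positivity), mul_comm]
  refine le_trans ?_ ((mul_meas_ge_le_integral_of_nonneg
    (ae_of_all _ fun ω => sq_nonneg _) hi (ε ^ 2)).trans hle)
  refine mul_le_mul_of_nonneg_left (measureReal_mono fun ω hω => ?_) (sq_nonneg ε)
  exact pow_le_pow_left₀ hε.le hω 2

end Convergence

/-! ### The main theorem -/

theorem theorem3 {N d : ℕ} (G : Game N d)
    (hconvex : G.IsConvex)
    (hcompact : ∀ i, IsCompact (G.A i))
    (hzero : ∀ i, (0 : PlayerAction d) ∈ interior (G.A i))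
    (ν : ℝ) (hν : 0 < ν) (hmono : G.StronglyMonotone ν)
    (α : ℝ) (hα : α < 2) (hgrowth : G.GrowthBound α)
    (hsmooth : Differentiable ℝ G.pseudoGradient ∨ ∃ l, LipschitzWith l G.pseudoGradient)
    (b c r s : ℝ) (hb : 0 < b) (hc : 0 < c) (hr : 1 ≤ r) (hrs : r < s)
    {Ω : Type*} [MeasurableSpace Ω] (P : Measure Ω) [IsProbabilityMeasure P]
    (μ ξ a : ℕ → Ω → Profile N d)
    (hrun : IsRun P G (fun t => 4 / (ν * (t : ℝ))) (fun t => b / (t : ℝ) ^ s)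
      (fun t => c / (t : ℝ) ^ r) μ ξ a) :
    ∃ aStar : Profile N d, G.IsNash aStar ∧ (∀ a', G.IsNash a' → a' = aStar) ∧
      (∀ᵐ ω ∂P, Tendsto (fun t => μ t ω) atTop (𝓝 aStar)) ∧
      TendstoInMeasure P ξ atTop (fun _ => aStar) ∧
      (∀ t, 2 ≤ t → Integrable (fun ω => ‖μ t ω - aStar‖ ^ 2) P) ∧
      (fun t : ℕ => ∫ ω, ‖μ t ω - aStar‖ ^ 2 ∂P) =O[atTop] (fun t : ℕ => 1 / (t : ℝ)) := by
  obtain ⟨S⟩ := nonempty_surrogate hconvex hcompact hzero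
  obtain ⟨x, hx⟩ := Game.exists_isNash hconvex hcompact (fun i => ⟨0, S.zero_mem i⟩) hν.le hmono
  obtain ⟨C, n₀, hC⟩ := exists_integral_sq_norm_le hconvex S hν hmono hx hb hc hr hrs hrun
  refine ⟨x, hx, fun y hy => hx.unique hconvex hν hmono hy,
    ae_tendsto_state hconvex S hν hb hc hr hrun hC,
    tendstoInMeasure_sample S hb (hr.trans hrs.le) hrun hC, fun t ht => ?_, ?_⟩
  -- From `t = 2` on the state is the output of a projection, hence bounded; the initial state may
  -- have no second moment.
  · obtain ⟨n, rfl⟩ : ∃ n, t = n + 1 := ⟨t - 1, by omega⟩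
    exact hrun.integrable_sq_norm_state_sub S (by omega) x
  · refine IsBigO.of_bound C ?_
    filter_upwards [eventually_ge_atTop (n₀ + 1)] with t ht
    obtain ⟨n, rfl⟩ : ∃ n, t = n + 1 := ⟨t - 1, by omega⟩
    rw [Real.norm_of_nonneg (integral_nonneg fun ω => sq_nonneg _),
      Real.norm_of_nonneg (by positivity), mul_one_div]
    push_cast
    exact hC n (by omega)
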